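/- **Setting.** There are two sorts, $s$ (states) and $d$ (distributions). Let $\Sigma=(\Sigma_s,\Sigma_d)$ be a probabilistically lifted signature: every $f\in\Sigma_s$ has a finite rank and an arity $\sigma_1\cdots\sigma_n\to s$ with $\sigma_i\in\{s,d\}$, and $\Sigma_d$ consists of the lifting $\mathbf f:d\cdots d\to d$ of each $f\in\Sigma_s$ (of the same rank), possibly of $\delta:s\to d$, and possibly of operators $\bigoplus_{i\in I}[p_i]\_:d^{|I|}\to d$ with $I$ finite, $p_i\in(0,1]$, $\sum_i p_i=1$. Terms are built over infinite sets of state variables and of distribution variables. A closed distribution term $\theta$ denotes a discrete probability distribution $[\![\theta]\!]$ on closed state terms: $[\![\delta(t)]\!]=\delta_t$; $[\![\bigoplus_i[p_i]\theta_i]\!]=\sum_i p_i[\![\theta_i]\!]$; and $[\![\mathbf f(\theta_1,\dots,\theta_n)]\!](f(\xi_1,\dots,\xi_n))=\prod_{\sigma_i=s}[\![\theta_i]\!](\xi_i)$ if $\xi_j=\theta_j$ whenever $\sigma_j=d$, and $[\![\mathbf f(\theta_1,\dots,\theta_n)]\!]$ vanishes on all other states. **PTSS.** Let $A$ be a set of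 actions with $\tau\in A$. A probabilistic transition system specification (PTSS) $P$ is a set of rules with an arbitrary set of premises of the forms $t\xrightarrow{a}\theta$ (positive) and $t\not\xrightarrow{b}$ (negative) and with a conclusion $t\xrightarrow{a}\theta$, where $t$ ranges over open state terms and $\theta$ over open distribution terms. For transition relations $CT\subseteq PT$ on closed state terms $\times A\times$ closed distribution terms, $\langle CT,PT\rangle$ is a 3-valued stable model of $P$ if a transition lies in $CT$ (resp. $PT$) iff it is provable in $P$ (by a well-founded proof tree) from some set of closed negative literals that all hold in $PT$ (resp. $CT$); here $t\not\xrightarrow{b}$ holds in $Tr$ if no $t\xrightarrow{b}\theta$ is in $Tr$. The least one has the smallest $CT$ and the largest $PT$. $P$ is *complete* if its least 3-valued stable model has the form $\langle Tr,Tr\rangle$; the PTS associated to $P$ then has the transitions $t\xrightarrow{a}[\![\theta]\!]$ for $t\xrightarrow{a}\theta$ in $Tr$. **Rooted branching bisimilarity.** A relation $B$ on states is lifted to distributions by $\pi\mathrel B\pi'$ iff there is a coupling of $\pi$ and $\pi'$ that is positive only on pairs in $B$. An equivalence relation $B$ on closed state terms is a *branching bisimulation* if $s\mathrel B s'$ and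 $s\xrightarrow{a}\pi$ imply that either $a=\tau$ and $\delta_s\mathrel B\pi$, or there is an execution $s'=s_0\xrightarrow{\tau}\pi_1,\ s_1\xrightarrow{\tau}\pi_2,\ \dots,\ s_{n-1}\xrightarrow{\tau}\pi_n,\ s_n\xrightarrow{a}\pi'$ with $n\ge0$, $s_j\in\mathrm{spt}(\pi_j)$ for $1\le j\le n$, such that $s\mathrel B s_i$ for $0\le i\le n$, $\delta_s\mathrel B\pi_j$ for $1\le j\le n$, and $\pi\mathrel B\pi'$. Write $s\approx_b t$ if some branching bisimulation relates $s$ and $t$. A symmetric relation $R$ on closed state terms is a *rooted branching bisimulation* if $s\mathrel R t$ and $s\xrightarrow{a}\pi$ imply $t\xrightarrow{a}\pi'$ for some $\pi'$ with $\pi\approx_b\pi'$. Write $s\approx_{rb}t$ if some rooted branching bisimulation relates them; for closed distribution terms, $\theta\approx_{rb}\theta'$ means that $[\![\theta]\!]$ and $[\![\theta']\!]$ are related by the lifting of $\approx_{rb}$. **Format.** The nesting graph of $P$ has the nodes $\langle f,i\rangle$ ($f\in\Sigma_s$, $1\le i\le\mathrm{rk}(f)$) and an edge $\langle f,i\rangle\to\langle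 g,j\rangle$ whenever some rule has a conclusion $f(\dots,\zeta_i,\dots)\xrightarrow{a}\theta$ with $\zeta_i$ a variable, where $\theta$ contains a subterm built with $g$ or $\mathbf g$ in whose $j$-th argument $\zeta_i$ occurs. The *wild* nodes form the smallest set closed under these edges and containing $\langle g,j\rangle$ whenever some rule has a premise $t\xrightarrow{a}\mu$ with $\mu$ a variable and its conclusion has a target with a subterm built with $g$ or $\mathbf g$ in whose $j$-th argument $\mu$ occurs. The $i$-th argument of $f$ and of $\mathbf f$ is wild if $\langle f,i\rangle$ is wild, and tame otherwise. An occurrence of a variable in a term is *w-nested* if all the operators $f\in\Sigma_s$ and $\mathbf f$ above it have it in a wild argument. For pairwise different variables, a *patience rule* for the $i$-th argument (of sort $s$) of $f\in\Sigma_s$ is $$\frac{x_i\xrightarrow{\tau}\mu}{f(\dots,\zeta_{i-1},x_i,\zeta_{i+1},\dots)\xrightarrow{\tau}\mathbf f(\dots,\overline{\zeta}_{i-1},\mu,\overline\zeta_{i+1},\dots)}$$ where $\overline\zeta=\delta(\zeta)$ if $\zeta$ has sort $s$ and $\overline\zeta=\zeta$ otherwise. $P$ is in the *probabilistic RBB safe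 format* if each of its rules $r$ is a patience rule for a wild argument, or has the shape $$\frac{\{t_m\xrightarrow{a_m}\mu_m\mid m\in M\}\quad\{t_n\not\xrightarrow{b_n}\mid n\in N\}}{f(\zeta_1,\dots,\zeta_{\mathrm{rk}(f)})\xrightarrow{a}\theta}$$ with all $\zeta_k$ and $\mu_m$ pairwise different variables, such that: (a) if the $i$-th argument of $f$ is wild and has a patience rule in $P$, then $\zeta_i=x_i$ occurs in at most one premise of $r$, and such a premise is of the form $x_i\xrightarrow{a_i}\mu_i$ with $a_i\ne\tau$; (b) if the $i$-th argument of $f$ is wild and has no patience rule in $P$, then $\zeta_i$ does not occur in the source of a premise; (c) the variables $\mu_m$, and the $\zeta_i$ for wild arguments $i$ of $f$, only occur at w-nested positions in $\theta$; (d) $\mu_m$ does not occur in $t_{m'}$, for all $m,m'\in M$. **Theorem.** Let $P$ be a complete PTSS in the probabilistic RBB safe format. Then $\approx_{rb}$ is a congruence for all operators of $P$: it is an equivalence relation on the closed terms of each sort, and for every operator $f\in\Sigma_s\cup\Sigma_d$ of rank $n$ and all closed terms $\xi_i,\xi'_i$ of the appropriate sorts, if $\xi_i\approx_{rb}\xi'_i$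 for all $i\le n$, then $f(\xi_1,\dots,\xi_n)\approx_{rb}f(\xi'_1,\dots,\xi'_n)$. -/

import Mathlib

universe u v w

namespace ProbSOS

open scoped ENNReal

/-! ### Sorts, signatures, terms -/

/-- The two sorts: `s` for states, `d` for distributions over states. -/
inductive Srt : Type
  | s : Srt
  | d : Srt

/-- A probabilistically lifted signature.  `Op` is the set of operators mapping into sort `s`; the
operator `f` has rank `rk f` and its `i`-th argument has sort `ar f i`.  The operators mapping into
sort `d` are: the lifting of every `f : Op` (all arguments of sort `d`), the operator `δ : s → d` if
`hasDirac` holds, and the operators `⨁ᵢ [pᵢ] _` with `n` arguments for those weight vectors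
`p` (probability vectors on `{0, …, n-1}` with all entries positive) that lie in `mixes n`. -/
structure Signature : Type (u + 1) where
  Op : Type u
  rk : Op → ℕ
  ar : (f : Op) → Fin (rk f) → Srt
  hasDirac : Prop
  mixes : (n : ℕ) → Set (PMF (Fin n))
  mixes_pos : ∀ (n : ℕ), ∀ p ∈ mixes n, ∀ i : Fin n, 0 < p i

/-- Terms over a signature and a sorted family of variables (`X .s` are the state variables, `X .d`
the distribution variables). -/
inductive Term (S : Signature.{u}) (X : Srt → Type v) : Srt → Type (max u v)
  | var {σ : Srt} (x : X σ) : Term S X σ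
  | app (f : S.Op) (args : ∀ i : Fin (S.rk f), Term S X (S.ar f i)) : Term S X Srt.s
  | lift (f : S.Op) (args : Fin (S.rk f) → Term S X Srt.d) : Term S X Srt.d
  | dirac (h : S.hasDirac) (t : Term S X Srt.s) : Term S X Srt.d
  | mix {n : ℕ} (p : PMF (Fin n)) (hp : p ∈ S.mixes n)
      (args : Fin n → Term S X Srt.d) : Term S X Srt.d

/-- Closed terms: terms without variables. -/
abbrev Closed (S : Signature.{u}) (σ : Srt) : Type u := Term S (fun _ => Empty) σ

/-- A (sort respecting) substitution. -/
abbrev Subst (S : Signature.{u}) (X Y : Srt → Type*) := ∀ σ : Srt, X σ → Term S Y σ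

variable {S : Signature.{u}} {X : Srt → Type v} {A : Type w}

/-- Extension of a substitution to terms. -/
def Term.subst {Y : Srt → Type*} (ρ : Subst S X Y) : {σ : Srt} → Term S X σ → Term S Y σ
  | _, .var x => ρ _ x
  | _, .app f args => .app f (fun i => (args i).subst ρ)
  | _, .lift f args => .lift f (fun i => (args i).subst ρ)
  | _, .dirac h t => .dirac h (t.subst ρ)
  | _, .mix p hp args => .mix p hp (fun i => (args i).subst ρ)

/-- The set of variables (each together with its sort) occurring in a term. -/
def Term.vars : {σ : Srt} → Term S X σ → Set (Σ σ : Srt, X σ)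
  | σ, .var x => {⟨σ, x⟩}
  | _, .app _ args => {z | ∃ i, z ∈ (args i).vars}
  | _, .lift _ args => {z | ∃ i, z ∈ (args i).vars}
  | _, .dirac _ t => t.vars
  | _, .mix _ _ args => {z | ∃ i, z ∈ (args i).vars}

/-! ### Contexts -/

/-- Contexts of sort `σ` with exactly one hole, of sort `κ`.  In the constructors with arguments the
entry of `args` at the position `i` of the hole is irrelevant. -/
inductive Ctx (S : Signature.{u}) (X : Srt → Type v) (κ : Srt) : Srt → Type (max u v)
  | hole : Ctx S X κ κ
  | app (f : S.Op) (i : Fin (S.rk f)) (C : Ctx S X κ (S.ar f i))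
      (args : ∀ j : Fin (S.rk f), Term S X (S.ar f j)) : Ctx S X κ Srt.s
  | lift (f : S.Op) (i : Fin (S.rk f)) (C : Ctx S X κ Srt.d)
      (args : Fin (S.rk f) → Term S X Srt.d) : Ctx S X κ Srt.d
  | dirac (h : S.hasDirac) (C : Ctx S X κ Srt.s) : Ctx S X κ Srt.d
  | mix {n : ℕ} (p : PMF (Fin n)) (hp : p ∈ S.mixes n) (i : Fin n) (C : Ctx S X κ Srt.d)
      (args : Fin n → Term S X Srt.d) : Ctx S X κ Srt.d

/-- `C.fill u` is `C[u]`. -/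
def Ctx.fill {κ : Srt} : {σ : Srt} → Ctx S X κ σ → Term S X κ → Term S X σ
  | _, .hole, u => u
  | _, .app f i C args, u => .app f (Function.update args i (C.fill u))
  | _, .lift f i C args, u => .lift f (Function.update args i (C.fill u))
  | _, .dirac h C, u => .dirac h (C.fill u)
  | _, .mix p hp i C args, u => .mix p hp (Function.update args i (C.fill u))

/-! ### Semantics of distribution terms -/

/-- The weights of a finite product of discrete distributions sum to one. -/
theorem tsum_prod_fin : ∀ (n : ℕ) (α : Fin n → Type u) (p : ∀ i, PMF (α i)),
    ∑' x : (∀ i, α i), ∏ i, p i (x i) = 1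
  | 0, α, p => by
      rw [tsum_eq_single (fun i => i.elim0) (fun b hb => (hb (funext fun i => i.elim0)).elim)]
      simp
  | n + 1, α, p => by
      rw [← (Fin.consEquiv α).tsum_eq, ENNReal.tsum_prod']
      simp only [Fin.prod_univ_succ, Fin.consEquiv_apply, Fin.cons_zero, Fin.cons_succ]
      simp only [ENNReal.tsum_mul_left]
      have h := tsum_prod_fin n (fun i => α i.succ) (fun i => p i.succ)
      simp only [h, mul_one]
      exact (p 0).tsum_coe

/-- Product of finitely many discrete distributions. -/
noncomputable def prodPMF {n : ℕ} {α : Fin n → Type u} (p : ∀ i, PMF (α i)) : PMF (∀ i, α i) :=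
  ⟨fun x => ∏ i, p i (x i), by
    rw [← tsum_prod_fin n α p]; exact ENNReal.summable.hasSum⟩

/-- The law of the `i`-th argument of a state `f(ξ₁, …, ξₙ)` drawn from the lifting of `f` applied to
`θ₁, …, θₙ`: it is the distribution `π = ⟦θᵢ⟧` at a position of sort `s`, and constantly the term
`θ = θᵢ` itself at a position of sort `d`. -/
noncomputable def argLaw : (σ : Srt) → Closed S Srt.d → PMF (Closed S Srt.s) → PMF (Closed S σ)
  | .s, _, π => π
  | .d, θ, _ => PMF.pure θ

/-- The interpretation `⟦θ⟧` of a closed distribution term.  (On closed state terms, where it is not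
used, the function is set to be the point mass.) -/
noncomputable def sem : {σ : Srt} → Closed S σ → PMF (Closed S Srt.s)
  | _, .var x => x.elim
  | _, .app f args => PMF.pure (.app f args)
  | _, .lift f args =>
      (prodPMF fun i => argLaw (S.ar f i) (args i) (sem (args i))).map (Term.app f)
  | _, .dirac _ t => PMF.pure t
  | _, .mix p _ args => p.bind fun i => sem (args i)

/-- The value of an interpreted lifted operator `f` at a state built with `f`. -/
theorem sem_lift_same (f : S.Op) (θ : Fin (S.rk f) → Closed S Srt.d)
    (ξ : ∀ i : Fin (S.rk f), Closed S (S.ar f i)) :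
    sem (Term.lift f θ) (Term.app f ξ) =
      ∏ i, argLaw (S.ar f i) (θ i) (sem (θ i)) (ξ i) := by
  classical
  simp only [sem, PMF.map_apply]
  rw [tsum_eq_single ξ]
  · simp [prodPMF, DFunLike.coe]
  · intro b hb
    rw [if_neg]
    intro h
    exact hb (by injection h with _ h; exact h.symm)

/-- The value of an interpreted lifted operator `f` at a state built with another operator. -/
theorem sem_lift_ne (f g : S.Op) (hfg : f ≠ g) (θ : Fin (S.rk f) → Closed S Srt.d)
    (ξ : ∀ i : Fin (S.rk g), Closed S (S.ar g i)) :
    sem (Term.lift f θ) (Term.app g ξ) = 0 := by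
  classical
  simp only [sem, PMF.map_apply]
  rw [ENNReal.tsum_eq_zero]
  intro b
  rw [if_neg]
  intro h
  injection h with h _
  exact hfg h.symm

/-! ### Literals, rules, proofs, stable models -/

/-- Positive literals `t —a→ θ` and negative literals `t —a↛`. -/
inductive Literal (S : Signature.{u}) (X : Srt → Type v) (A : Type w) : Type (max u v w)
  | pos (t : Term S X Srt.s) (a : A) (θ : Term S X Srt.d) : Literal S X A
  | neg (t : Term S X Srt.s) (a : A) : Literal S X A

/-- The source of a literal. -/
def Literal.src : Literal S X A → Term S X Srt.s
  | .pos t _ _ => t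
  | .neg t _ => t

/-- The variables of a literal. -/
def Literal.vars : Literal S X A → Set (Σ σ : Srt, X σ)
  | .pos t _ θ => t.vars ∪ θ.vars
  | .neg t _ => t.vars

def Literal.IsNegative : Literal S X A → Prop
  | .pos _ _ _ => False
  | .neg _ _ => True

def Literal.subst {Y : Srt → Type*} (ρ : Subst S X Y) : Literal S X A → Literal S Y A
  | .pos t a θ => .pos (t.subst ρ) a (θ.subst ρ)
  | .neg t a => .neg (t.subst ρ) a

/-- A rule with set of premises `prem` and conclusion `src —act→ tgt`. -/
structure Rule (S : Signature.{u}) (X : Srt → Type v) (A : Type w) : Type (max u v w) where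
  prem : Set (Literal S X A)
  src : Term S X Srt.s
  act : A
  tgt : Term S X Srt.d

/-- The conclusion of a rule. -/
def Rule.conc (r : Rule S X A) : Literal S X A := .pos r.src r.act r.tgt

/-- A probabilistic transition system specification over the signature `S`, with variables `X` and
actions `A`, is a set of rules. -/
abbrev PTSS (S : Signature.{u}) (X : Srt → Type v) (A : Type w) := Set (Rule S X A)

/-- `Provable P H ψ`: there is a well-founded proof tree from `P` with root `ψ` whose leaves are
hypotheses from `H` or instances of rules without premises. -/
inductive Provable {Y : Srt → Type*} (P : PTSS S X A) (H : Set (Literal S Y A)) :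
    Literal S Y A → Prop
  | hyp (χ : Literal S Y A) (hχ : χ ∈ H) : Provable P H χ
  | rule (r : Rule S X A) (hr : r ∈ P) (ρ : Subst S X Y)
      (hprem : ∀ φ ∈ r.prem, Provable P H (φ.subst ρ)) : Provable P H (r.conc.subst ρ)

/-- (Symbolic) transition relations. -/
abbrev TransRel (S : Signature.{u}) (A : Type w) := Closed S Srt.s → A → Closed S Srt.d → Prop

/-- A closed literal holds in a transition relation. -/
def Holds (Tr : TransRel S A) : Literal S (fun _ => Empty) A → Prop
  | .pos t a θ => Tr t a θ
  | .neg t a => ∀ θ : Closed S Srt.d, ¬ Tr t a θ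

/-- `t —a→ θ` is provable from negative literals that all hold in `Tr`. -/
def Supported (P : PTSS S X A) (Tr : TransRel S A) : TransRel S A := fun t a θ =>
  ∃ N : Set (Literal S (fun _ => Empty) A), (∀ φ ∈ N, φ.IsNegative) ∧
    Provable P N (.pos t a θ) ∧ ∀ φ ∈ N, Holds Tr φ

/-- `⟨CT, PT⟩` is a 3-valued stable model of `P`. -/
structure IsStableModel (P : PTSS S X A) (CT PT : TransRel S A) : Prop where
  le : ∀ t a θ, CT t a θ → PT t a θ
  certain : ∀ t a θ, CT t a θ ↔ Supported P PT t a θ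
  possible : ∀ t a θ, PT t a θ ↔ Supported P CT t a θ

/-- `⟨CT, PT⟩` is the 3-valued stable model of `P` that is least in the information ordering. -/
def IsLeastStableModel (P : PTSS S X A) (CT PT : TransRel S A) : Prop :=
  IsStableModel P CT PT ∧ ∀ CT' PT' : TransRel S A, IsStableModel P CT' PT' →
    (∀ t a θ, CT t a θ → CT' t a θ) ∧ (∀ t a θ, PT' t a θ → PT t a θ)

/-- `P` is complete: its least 3-valued stable model is 2-valued. -/
def IsComplete (P : PTSS S X A) : Prop :=
  ∃ Tr : TransRel S A, IsLeastStableModel P Tr Tr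

/-- The transition relation associated to a complete PTSS. -/
def assocRel (P : PTSS S X A) (hP : IsComplete P) : TransRel S A := hP.choose

/-- The PTS associated to a complete PTSS. -/
def assocPTS (P : PTSS S X A) (hP : IsComplete P) :
    Closed S Srt.s → A → PMF (Closed S Srt.s) → Prop :=
  fun t a π => ∃ θ : Closed S Srt.d, assocRel P hP t a θ ∧ sem θ = π

/-! ### Rooted branching bisimilarity -/

section Bisim

variable {Q : Type u}

/-- The lifting of a relation to discrete distributions, by weight functions. -/
def LiftRel (B : Q → Q → Prop) (π π' : PMF Q) : Prop :=
  ∃ m : Q → Q → ℝ≥0∞, (∀ t, ∑' t', m t t' = π t) ∧ (∀ t', ∑' t, m t t' = π' t') ∧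
    ∀ t t', 0 < m t t' → B t t'

/-- `TauPath τ tr B s t t'`: there is a concrete execution `t₀ τ π₁ t₁ τ π₂ t₂ … πₙ tₙ` of the PTS
`tr` with `n ≥ 0`, `t = t₀`, `t' = tₙ`, with `B s tᵢ` for all `i` and `δ_s B πⱼ` for all `j`. -/
inductive TauPath (τ : A) (tr : Q → A → PMF Q → Prop) (B : Q → Q → Prop) (s : Q) : Q → Q → Prop
  | nil {t : Q} (h : B s t) : TauPath τ tr B s t t
  | cons {t t₁ t' : Q} {π : PMF Q} (h : B s t) (htr : tr t τ π) (hπ : LiftRel B (PMF.pure s) π)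
      (ht₁ : t₁ ∈ π.support) (hrest : TauPath τ tr B s t₁ t') : TauPath τ tr B s t t'

/-- `B` is a branching bisimulation (without schedulers) for the PTS `tr`. -/
def IsBranchingBisim (τ : A) (tr : Q → A → PMF Q → Prop) (B : Q → Q → Prop) : Prop :=
  Equivalence B ∧ ∀ s t : Q, B s t → ∀ (a : A) (π : PMF Q), tr s a π →
    (a = τ ∧ LiftRel B (PMF.pure s) π) ∨
    ∃ (t' : Q) (π' : PMF Q), TauPath τ tr B s t t' ∧ tr t' a π' ∧ LiftRel B π π'

/-- Branching bisimilarity. -/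
def BranchingBisimilar (τ : A) (tr : Q → A → PMF Q → Prop) (s t : Q) : Prop :=
  ∃ B : Q → Q → Prop, IsBranchingBisim τ tr B ∧ B s t

/-- `E` is a rooted branching bisimulation for the PTS `tr`. -/
def IsRootedBranchingBisim (τ : A) (tr : Q → A → PMF Q → Prop) (E : Q → Q → Prop) : Prop :=
  (∀ s t : Q, E s t → E t s) ∧ ∀ s t : Q, E s t → ∀ (a : A) (π : PMF Q), tr s a π →
    ∃ π' : PMF Q, tr t a π' ∧ LiftRel (BranchingBisimilar τ tr) π π'

/-- Rooted branching bisimilarity. -/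
def RootedBranchingBisimilar (τ : A) (tr : Q → A → PMF Q → Prop) (s t : Q) : Prop :=
  ∃ E : Q → Q → Prop, IsRootedBranchingBisim τ tr E ∧ E s t

end Bisim

/-- Rooted branching bisimilarity of a complete PTSS on closed terms of both sorts: on state terms it
is that of the associated PTS, on distribution terms it is the lifting of the latter to the
interpretations. -/
def rbBisim (τ : A) (P : PTSS S X A) (hP : IsComplete P) :
    (σ : Srt) → Closed S σ → Closed S σ → Prop
  | .s, t, t' => RootedBranchingBisimilar τ (assocPTS P hP) t t'
  | .d, θ, θ' => LiftRel (RootedBranchingBisimilar τ (assocPTS P hP)) (sem θ) (sem θ')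

/-- A sorted relation on closed terms is a congruence: an equivalence relation compatible with all
operators of the signature. -/
structure IsCongruence (E : (σ : Srt) → Closed S σ → Closed S σ → Prop) : Prop where
  equivalence : ∀ σ : Srt, Equivalence (E σ)
  app : ∀ (f : S.Op) (ξ ξ' : ∀ i : Fin (S.rk f), Closed S (S.ar f i)),
    (∀ i, E (S.ar f i) (ξ i) (ξ' i)) → E Srt.s (Term.app f ξ) (Term.app f ξ')
  lift : ∀ (f : S.Op) (θ θ' : Fin (S.rk f) → Closed S Srt.d),
    (∀ i, E Srt.d (θ i) (θ' i)) → E Srt.d (Term.lift f θ) (Term.lift f θ')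
  dirac : ∀ (h : S.hasDirac) (t t' : Closed S Srt.s),
    E Srt.s t t' → E Srt.d (Term.dirac h t) (Term.dirac h t')
  mix : ∀ (n : ℕ) (p : PMF (Fin n)) (hp : p ∈ S.mixes n) (θ θ' : Fin n → Closed S Srt.d),
    (∀ i, E Srt.d (θ i) (θ' i)) → E Srt.d (Term.mix p hp θ) (Term.mix p hp θ')

/-! ### The probabilistic RBB safe format -/

/-- `Under z g j θ`: `θ = C[g(.., C'[z], ..)]` or `θ = C[𝐠(.., C'[z], ..)]`, with `𝐠` the lifting of
`g`, for some contexts `C`, `C'`, where `C'[z]` is the `j`-th argument. -/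
def Under {κ : Srt} (z : X κ) (g : S.Op) (j : Fin (S.rk g)) (θ : Term S X Srt.d) : Prop :=
  (∃ (C : Ctx S X Srt.s Srt.d) (C' : Ctx S X κ (S.ar g j))
      (args : ∀ k : Fin (S.rk g), Term S X (S.ar g k)),
    args j = C'.fill (.var z) ∧ θ = C.fill (.app g args)) ∨
  (∃ (C : Ctx S X Srt.d Srt.d) (C' : Ctx S X κ Srt.d) (args : Fin (S.rk g) → Term S X Srt.d),
    args j = C'.fill (.var z) ∧ θ = C.fill (.lift g args))

/-- The edges of the nesting graph of `P`. -/
def NestingEdge (P : PTSS S X A) (f : S.Op) (i : Fin (S.rk f)) (g : S.Op) (j : Fin (S.rk g)) :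
    Prop :=
  ∃ r ∈ P, ∃ (args : ∀ k : Fin (S.rk f), Term S X (S.ar f k)) (z : X (S.ar f i)),
    r.src = .app f args ∧ args i = .var z ∧ Under z g j r.tgt

/-- `Wild P g j`: the `j`-th argument of `g` (and of the lifting of `g`) is wild; it is tame
otherwise. -/
inductive Wild (P : PTSS S X A) : (g : S.Op) → Fin (S.rk g) → Prop
  | base (r : Rule S X A) (hr : r ∈ P) (t : Term S X Srt.s) (a : A) (μ : X Srt.d)
      (hprem : Literal.pos t a (.var μ) ∈ r.prem) (g : S.Op) (j : Fin (S.rk g))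
      (htgt : Under μ g j r.tgt) : Wild P g j
  | step (f : S.Op) (i : Fin (S.rk f)) (g : S.Op) (j : Fin (S.rk g))
      (hE : NestingEdge P f i g j) (hf : Wild P f i) : Wild P g j

/-- w-nested contexts. -/
def Ctx.WNested (P : PTSS S X A) {κ : Srt} : {σ : Srt} → Ctx S X κ σ → Prop
  | _, .hole => True
  | _, .app f i C _ => Wild P f i ∧ C.WNested P
  | _, .lift f i C _ => Wild P f i ∧ C.WNested P
  | _, .dirac _ C => C.WNested P
  | _, .mix _ _ _ C _ => C.WNested P

/-- The variable `z` only occurs at w-nested positions in `θ`. -/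
def OnlyWNested (P : PTSS S X A) {κ : Srt} (z : X κ) (θ : Term S X Srt.d) : Prop :=
  ∀ C : Ctx S X κ Srt.d, C.fill (.var z) = θ → C.WNested P

/-- `IsBar z θ`: `θ` is `δ(z)` if `z` has sort `s`, and `z` itself if `z` has sort `d`. -/
inductive IsBar : {σ : Srt} → X σ → Term S X Srt.d → Prop
  | state (x : X Srt.s) (h : S.hasDirac) : IsBar x (.dirac h (.var x))
  | dist (μ : X Srt.d) : IsBar μ (.var μ)

/-- The variables `ζ₁, …, ζₙ` are pairwise different. -/
def AllDifferent {f : S.Op} (ζ : ∀ i : Fin (S.rk f), X (S.ar f i)) : Prop :=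
  ∀ i j, (⟨S.ar f i, ζ i⟩ : Σ σ : Srt, X σ) = ⟨S.ar f j, ζ j⟩ → i = j

/-- The variable `z` is one of `ζ₁, …, ζₙ`. -/
def IsOneOf {κ : Srt} (z : X κ) {f : S.Op} (ζ : ∀ i : Fin (S.rk f), X (S.ar f i)) : Prop :=
  ∃ i, (⟨S.ar f i, ζ i⟩ : Σ σ : Srt, X σ) = ⟨κ, z⟩

/-- `r` is a patience rule for the `i`-th argument (necessarily of sort `s`) of `f`. -/
def IsPatienceRule (τ : A) (f : S.Op) (i : Fin (S.rk f)) (r : Rule S X A) : Prop :=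
  ∃ (ζ : ∀ j : Fin (S.rk f), X (S.ar f j)) (x : X Srt.s) (μ : X Srt.d)
      (θ : Fin (S.rk f) → Term S X Srt.d),
    AllDifferent ζ ∧ ¬ IsOneOf μ ζ ∧ (⟨S.ar f i, ζ i⟩ : Σ σ : Srt, X σ) = ⟨Srt.s, x⟩ ∧
    r.prem = {Literal.pos (.var x) τ (.var μ)} ∧
    r.src = .app f (fun j => .var (ζ j)) ∧ r.act = τ ∧ r.tgt = .lift f θ ∧
    θ i = .var μ ∧ ∀ j, j ≠ i → IsBar (ζ j) (θ j)

/-- The `i`-th argument of `f` has a patience rule in `P`. -/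
def HasPatienceRule (τ : A) (P : PTSS S X A) (f : S.Op) (i : Fin (S.rk f)) : Prop :=
  ∃ r ∈ P, IsPatienceRule τ f i r

/-- `r` is an RBB safe rule, for the operator `f` and the variables `ζ` in the source of its
conclusion. -/
structure IsRBBSafeRule (τ : A) (P : PTSS S X A) (r : Rule S X A) (f : S.Op)
    (ζ : ∀ i : Fin (S.rk f), X (S.ar f i)) : Prop where
  src_eq : r.src = .app f (fun i => .var (ζ i))
  src_different : AllDifferent ζ
  /-- The targets of the positive premises are variables, different from the `ζᵢ`, … -/
  target_var : ∀ t a θ, Literal.pos t a θ ∈ r.prem → ∃ μ : X Srt.d, θ = .var μ ∧ ¬ IsOneOf μ ζ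
  /-- … and different premises have different targets. -/
  target_different : ∀ t a t' a' (μ : X Srt.d), Literal.pos t a (.var μ) ∈ r.prem →
    Literal.pos t' a' (.var μ) ∈ r.prem → t = t' ∧ a = a'
  /-- A wild argument with a patience rule occurs in at most one premise, and this premise is of the
  form `xᵢ —a→ μ` with `a ≠ τ`. -/
  wild_patience : ∀ i, Wild P f i → HasPatienceRule τ P f i →
    (∀ ψ ∈ r.prem, (⟨S.ar f i, ζ i⟩ : Σ σ : Srt, X σ) ∈ ψ.vars →
      ∃ (x : X Srt.s) (a : A) (μ : X Srt.d),
        (⟨S.ar f i, ζ i⟩ : Σ σ : Srt, X σ) = ⟨Srt.s, x⟩ ∧ a ≠ τ ∧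
        ψ = .pos (.var x) a (.var μ)) ∧
    (∀ ψ ∈ r.prem, ∀ ψ' ∈ r.prem, (⟨S.ar f i, ζ i⟩ : Σ σ : Srt, X σ) ∈ ψ.vars →
      (⟨S.ar f i, ζ i⟩ : Σ σ : Srt, X σ) ∈ ψ'.vars → ψ = ψ')
  /-- A wild argument without a patience rule does not occur in the source of a premise. -/
  wild_no_patience : ∀ i, Wild P f i → ¬ HasPatienceRule τ P f i →
    ∀ ψ ∈ r.prem, (⟨S.ar f i, ζ i⟩ : Σ σ : Srt, X σ) ∉ ψ.src.vars
  /-- Targets of positive premises only occur at w-nested positions in the target. -/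
  target_nested : ∀ t a (μ : X Srt.d), Literal.pos t a (.var μ) ∈ r.prem → OnlyWNested P μ r.tgt
  /-- Wild arguments only occur at w-nested positions in the target. -/
  wild_nested : ∀ i, Wild P f i → OnlyWNested P (ζ i) r.tgt
  /-- No look-ahead: the target of a positive premise does not occur in the source of a positive
  premise. -/
  no_lookahead : ∀ t a (μ : X Srt.d) t' a' θ', Literal.pos t a (.var μ) ∈ r.prem →
    Literal.pos t' a' θ' ∈ r.prem → (⟨Srt.d, μ⟩ : Σ σ : Srt, X σ) ∉ t'.vars

/-- `P` is in the probabilistic RBB safe specification format. -/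
def IsRBBSafe (τ : A) (P : PTSS S X A) : Prop :=
  ∀ r ∈ P, (∃ f i, Wild P f i ∧ IsPatienceRule τ f i r) ∨ ∃ f ζ, IsRBBSafeRule τ P r f ζ

end ProbSOS

namespace ProbSOS

open scoped ENNReal

/-! ### Lifting relations to distributions -/

section Lifting

variable {Q Q' : Type u}

/-! Two relations carry the proof. `RootedClosure` is rooted branching bisimilarity closed under all
operators. `BranchClosure` is the closure containing branching bisimilarity and `RootedClosure` in
which wild arguments may again be related by the closure itself, while tame arguments must be
related by `RootedClosure`. If `RootedClosure` matches single transitions up to `BranchClosure`, and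
`BranchClosure` is contained in branching bisimilarity, then `RootedClosure` is a rooted branching
bisimulation, and congruence follows.

For the first claim (`RootedClosure.exists_assocRel`), the rule that fires on one side is fired on
the other, by induction on proofs. The targets of its positive premises become related by
`BranchClosure` only; this suffices because the format keeps them at w-nested positions
(`WildClosure.subst`). For the second claim (`BranchClosure.sortedBranchTransfer`), a wild argument
is either not tested by premises or has a patience rule and is tested at most once, for an action
other than `τ`. In the latter case patience rules lift the τ-path answering the test to the whole
term, and then the rule fires. A transition due to a patience rule is inert or matched because the
argument's own τ-step is.

Negative premises escape induction on proofs. They are handled beforehand: related states have the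
same initial actions, by induction over the approximations of the least stable model
(`InitClosure.exists_assocRel`). Since `BranchClosure` need not be transitive, `IsBranchingTransfer`
supplies a bisimulation principle up to reflexive-transitive closure. Probabilities enter only
through couplings, which can be pushed through products, mixtures and images. -/

theorem map_fst_apply (ω : PMF (Q × Q)) (t : Q) :
    ω.map Prod.fst t = ∑' b, ω (t, b) := by
  classical
  rw [PMF.map_apply, ENNReal.tsum_prod', tsum_eq_single t]
  · simp
  · intro b hb
    simp [hb.symm]

theorem map_snd_apply (ω : PMF (Q × Q)) (t : Q) :
    ω.map Prod.snd t = ∑' a, ω (a, t) := by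
  classical
  rw [PMF.map_apply, ENNReal.tsum_prod']
  refine tsum_congr fun a => ?_
  rw [tsum_eq_single t]
  · simp
  · intro b hb
    simp [hb.symm]

/-- A relation is lifted to `π` and `π'` iff there is a coupling supported on it. -/
theorem liftRel_iff_coupling {B : Q → Q → Prop} {π π' : PMF Q} :
    LiftRel B π π' ↔ ∃ ω : PMF (Q × Q), ω.map Prod.fst = π ∧ ω.map Prod.snd = π' ∧
      ∀ x ∈ ω.support, B x.1 x.2 := by
  constructor
  · rintro ⟨m, h₁, h₂, hB⟩
    have hsum : ∑' x : Q × Q, m x.1 x.2 = 1 := by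
      rw [ENNReal.tsum_prod']
      simp only [h₁]
      exact π.tsum_coe
    obtain ⟨ω, hω⟩ : ∃ ω : PMF (Q × Q), ∀ a b, ω (a, b) = m a b :=
      ⟨⟨fun x => m x.1 x.2, hsum ▸ ENNReal.summable.hasSum⟩, fun _ _ => rfl⟩
    refine ⟨ω, ?_, ?_, ?_⟩
    · ext t
      rw [map_fst_apply, ← h₁ t]
      simp only [hω]
    · ext t
      rw [map_snd_apply, ← h₂ t]
      simp only [hω]
    · intro x hx
      exact hB _ _ (pos_iff_ne_zero.2 (hω x.1 x.2 ▸ hx))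
  · rintro ⟨ω, rfl, rfl, hB⟩
    exact ⟨fun a b => ω (a, b), fun t => (map_fst_apply ω t).symm,
      fun t => (map_snd_apply ω t).symm, fun t t' h => hB (t, t') h.ne'⟩

theorem LiftRel.mono {B C : Q → Q → Prop} (h : ∀ s t, B s t → C s t) {π π' : PMF Q}
    (hπ : LiftRel B π π') : LiftRel C π π' := by
  obtain ⟨m, h₁, h₂, hB⟩ := hπ
  exact ⟨m, h₁, h₂, fun t t' ht => h _ _ (hB t t' ht)⟩

theorem LiftRel.symm {B : Q → Q → Prop} (h : ∀ s t, B s t → B t s) {π π' : PMF Q}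
    (hπ : LiftRel B π π') : LiftRel B π' π := by
  obtain ⟨m, h₁, h₂, hB⟩ := hπ
  exact ⟨fun a b => m b a, h₂, h₁, fun t t' ht => h _ _ (hB t' t ht)⟩

theorem LiftRel.refl {B : Q → Q → Prop} (h : ∀ s, B s s) (π : PMF Q) : LiftRel B π π := by
  refine liftRel_iff_coupling.2 ⟨π.map fun s => (s, s), ?_, ?_, ?_⟩
  · rw [PMF.map_comp]; exact PMF.map_id π
  · rw [PMF.map_comp]; exact PMF.map_id π
  · rintro x hx
    obtain ⟨s, -, rfl⟩ := (PMF.mem_support_map_iff _ _ _).1 hx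
    exact h s

/-- Couplings are glued along the middle marginal: given the middle state, the outer two are drawn
independently. -/
theorem LiftRel.comp {B C D : Q → Q → Prop} (h : ∀ s t u, B s t → C t u → D s u)
    {π π' π'' : PMF Q} (h₁ : LiftRel B π π') (h₂ : LiftRel C π' π'') : LiftRel D π π'' := by
  obtain ⟨m, hm₁, hm₂, hB⟩ := h₁
  obtain ⟨n, hn₁, hn₂, hC⟩ := h₂
  -- Where `π' b = 0`, the whole column of `m` vanishes, so the convention for `0 / 0` does no harm.
  have hm : ∀ a b, m a b * (π' b / π' b) = m a b := by
    intro a b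
    rcases eq_or_ne (π' b) 0 with h0 | h0
    · have : m a b = 0 := by
        rw [← hm₂ b] at h0
        exact ENNReal.tsum_eq_zero.1 h0 a
      simp [this]
    · rw [ENNReal.div_self h0 (π'.apply_ne_top b), mul_one]
  have hn : ∀ b c, n b c * (π' b / π' b) = n b c := by
    intro b c
    rcases eq_or_ne (π' b) 0 with h0 | h0
    · have : n b c = 0 := by
        rw [← hn₁ b] at h0
        exact ENNReal.tsum_eq_zero.1 h0 c
      simp [this]
    · rw [ENNReal.div_self h0 (π'.apply_ne_top b), mul_one]
  refine ⟨fun a c => ∑' b, m a b * n b c / π' b, fun a => ?_, fun c => ?_, fun a c hac => ?_⟩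
  · rw [ENNReal.tsum_comm, ← hm₁ a]
    refine tsum_congr fun b => ?_
    simp only [div_eq_mul_inv, mul_assoc]
    rw [ENNReal.tsum_mul_left, ENNReal.tsum_mul_right, hn₁ b, ← div_eq_mul_inv, hm]
  · rw [ENNReal.tsum_comm, ← hn₂ c]
    refine tsum_congr fun b => ?_
    simp only [div_eq_mul_inv, mul_assoc]
    rw [ENNReal.tsum_mul_right, hm₂ b, mul_left_comm, ← div_eq_mul_inv, hn]
  · obtain ⟨b, hb⟩ : ∃ b, m a b * n b c / π' b ≠ 0 := by
      by_contra! hcon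
      exact hac.ne' (ENNReal.tsum_eq_zero.2 hcon)
    have hb' : m a b * n b c ≠ 0 := fun h0 => hb (by simp [h0])
    exact h a b c (hB _ _ (pos_iff_ne_zero.2 (left_ne_zero_of_mul hb')))
      (hC _ _ (pos_iff_ne_zero.2 (right_ne_zero_of_mul hb')))

theorem LiftRel.equivalence {B : Q → Q → Prop} (h : Equivalence B) : Equivalence (LiftRel B) :=
  ⟨LiftRel.refl h.refl, LiftRel.symm fun _ _ => h.symm,
    LiftRel.comp (B := B) (C := B) (D := B) fun _ _ _ => h.trans⟩

theorem LiftRel.exists_right {B : Q → Q → Prop} {π π' : PMF Q} (h : LiftRel B π π') {s : Q}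
    (hs : s ∈ π.support) : ∃ t ∈ π'.support, B s t := by
  obtain ⟨ω, rfl, rfl, hB⟩ := liftRel_iff_coupling.1 h
  obtain ⟨x, hx, rfl⟩ := (PMF.mem_support_map_iff _ _ _).1 hs
  exact ⟨x.2, (PMF.mem_support_map_iff _ _ _).2 ⟨x, hx, rfl⟩, hB x hx⟩

theorem LiftRel.exists_left {B : Q → Q → Prop} {π π' : PMF Q} (h : LiftRel B π π') {t : Q}
    (ht : t ∈ π'.support) : ∃ s ∈ π.support, B s t := by
  obtain ⟨ω, rfl, rfl, hB⟩ := liftRel_iff_coupling.1 h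
  obtain ⟨x, hx, rfl⟩ := (PMF.mem_support_map_iff _ _ _).1 ht
  exact ⟨x.1, (PMF.mem_support_map_iff _ _ _).2 ⟨x, hx, rfl⟩, hB x hx⟩

/-- Every coupling with a point mass pairs `s` with each state of the support. Hence inertness can
be checked state by state. -/
theorem liftRel_pure_left {B : Q → Q → Prop} {s : Q} {π : PMF Q} :
    LiftRel B (PMF.pure s) π ↔ ∀ t ∈ π.support, B s t := by
  constructor
  · intro h t ht
    obtain ⟨s', hs', hB⟩ := h.exists_left ht
    rw [PMF.support_pure, Set.mem_singleton_iff] at hs'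
    exact hs' ▸ hB
  · intro h
    refine liftRel_iff_coupling.2 ⟨π.map fun t => (s, t), ?_, ?_, ?_⟩
    · rw [PMF.map_comp]; exact PMF.map_const π s
    · rw [PMF.map_comp]; exact PMF.map_id π
    · rintro x hx
      obtain ⟨t, ht, rfl⟩ := (PMF.mem_support_map_iff _ _ _).1 hx
      exact h t ht

theorem liftRel_pure_pure {B : Q → Q → Prop} {s t : Q} (h : B s t) :
    LiftRel B (PMF.pure s) (PMF.pure t) :=
  liftRel_pure_left.2 fun t' ht' => by
    rw [PMF.support_pure, Set.mem_singleton_iff] at ht'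
    exact ht' ▸ h

theorem LiftRel.bind {ι : Type*} {B : Q → Q → Prop} (p : PMF ι) {π π' : ι → PMF Q}
    (h : ∀ i, LiftRel B (π i) (π' i)) : LiftRel B (p.bind π) (p.bind π') := by
  choose ω h₁ h₂ hB using fun i => liftRel_iff_coupling.1 (h i)
  refine liftRel_iff_coupling.2 ⟨p.bind ω, ?_, ?_, ?_⟩
  · rw [PMF.map_bind]; simp only [h₁]
  · rw [PMF.map_bind]; simp only [h₂]
  · intro x hx
    obtain ⟨i, -, hi⟩ := (PMF.mem_support_bind_iff _ _ _).1 hx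
    exact hB i x hi

theorem LiftRel.map {B : Q → Q → Prop} {C : Q' → Q' → Prop} (g : Q → Q')
    (hg : ∀ s t, B s t → C (g s) (g t)) {π π' : PMF Q} (h : LiftRel B π π') :
    LiftRel C (π.map g) (π'.map g) := by
  obtain ⟨ω, rfl, rfl, hB⟩ := liftRel_iff_coupling.1 h
  refine liftRel_iff_coupling.2 ⟨ω.map (Prod.map g g), ?_, ?_, ?_⟩
  · simp only [PMF.map_comp]; rfl
  · simp only [PMF.map_comp]; rfl
  · intro x hx
    obtain ⟨y, hy, rfl⟩ := (PMF.mem_support_map_iff _ _ _).1 hx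
    exact hg _ _ (hB y hy)

end Lifting

/-! ### Finite products of distributions -/

theorem tsum_pi_prod : ∀ (n : ℕ) (α : Fin n → Type u) (f : ∀ i, α i → ℝ≥0∞),
    ∑' x : (∀ i, α i), ∏ i, f i (x i) = ∏ i, ∑' y, f i y
  | 0, α, f => by
      rw [tsum_eq_single (fun i => i.elim0) (fun b hb => (hb (funext fun i => i.elim0)).elim)]
      simp
  | n + 1, α, f => by
      rw [← (Fin.consEquiv α).tsum_eq, ENNReal.tsum_prod']
      simp only [Fin.prod_univ_succ, Fin.consEquiv_apply, Fin.cons_zero, Fin.cons_succ]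
      simp only [ENNReal.tsum_mul_left]
      rw [tsum_pi_prod n (fun i => α i.succ) (fun i => f i.succ), ENNReal.tsum_mul_right]

theorem prodPMF_apply {n : ℕ} {α : Fin n → Type u} (p : ∀ i, PMF (α i)) (x : ∀ i, α i) :
    prodPMF p x = ∏ i, p i (x i) := rfl

theorem mem_support_prodPMF {n : ℕ} {α : Fin n → Type u} {p : ∀ i, PMF (α i)} {x : ∀ i, α i} :
    x ∈ (prodPMF p).support ↔ ∀ i, x i ∈ (p i).support := by
  simp [PMF.mem_support_iff, prodPMF_apply, Finset.prod_eq_zero_iff]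

theorem map_prodPMF {n : ℕ} {α β : Fin n → Type u} (p : ∀ i, PMF (α i)) (g : ∀ i, α i → β i) :
    (prodPMF p).map (fun x i => g i (x i)) = prodPMF fun i => (p i).map (g i) := by
  classical
  ext y
  rw [PMF.map_apply, prodPMF_apply]
  simp only [PMF.map_apply]
  rw [← tsum_pi_prod n α fun i x => if y i = g i x then p i x else 0]
  refine tsum_congr fun x => ?_
  -- A product of indicators is the indicator of the conjunction, here of the equality of tuples.
  rw [Finset.prod_ite_zero]
  simp [prodPMF_apply, funext_iff]

/-- The independent product of couplings of the coordinates is a coupling of the products. -/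
theorem LiftRel.prod {n : ℕ} {α : Fin n → Type u} {B : ∀ i, α i → α i → Prop}
    {p p' : ∀ i, PMF (α i)} (h : ∀ i, LiftRel (B i) (p i) (p' i)) :
    LiftRel (fun x y => ∀ i, B i (x i) (y i)) (prodPMF p) (prodPMF p') := by
  choose ω h₁ h₂ hB using fun i => liftRel_iff_coupling.1 (h i)
  refine liftRel_iff_coupling.2
    ⟨(prodPMF ω).map fun x => (fun i => (x i).1, fun i => (x i).2), ?_, ?_, ?_⟩
  · rw [PMF.map_comp, ← funext h₁]
    exact map_prodPMF ω fun _ => Prod.fst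
  · rw [PMF.map_comp, ← funext h₂]
    exact map_prodPMF ω fun _ => Prod.snd
  · intro z hz i
    obtain ⟨x, hx, rfl⟩ := (PMF.mem_support_map_iff _ _ _).1 hz
    exact hB i _ (mem_support_prodPMF.1 hx i)

/-! ### Branching bisimulations -/

section Branching

variable {A : Type w} {Q : Type u} {τ : A} {tr : Q → A → PMF Q → Prop}

theorem TauPath.mono {B C : Q → Q → Prop} {s s' t t' : Q} (h : ∀ u, B s u → C s' u)
    (hp : TauPath τ tr B s t t') : TauPath τ tr C s' t t' := by
  induction hp with
  | nil hB => exact .nil (h _ hB)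
  | cons hB htr hπ ht₁ _ ih =>
    exact .cons (h _ hB) htr
      (liftRel_pure_left.2 fun u hu => h u (liftRel_pure_left.1 hπ u hu)) ht₁ ih

theorem TauPath.trans {B : Q → Q → Prop} {s t t' t'' : Q} (h₁ : TauPath τ tr B s t t')
    (h₂ : TauPath τ tr B s t' t'') : TauPath τ tr B s t t'' := by
  induction h₁ with
  | nil _ => exact h₂
  | cons hB htr hπ ht₁ _ ih => exact .cons hB htr hπ ht₁ (ih h₂)

theorem TauPath.rel_last {B : Q → Q → Prop} {s t t' : Q} (h : TauPath τ tr B s t t') :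
    B s t' := by
  induction h with
  | nil hB => exact hB
  | cons _ _ _ _ _ ih => exact ih

/-- A symmetric relation that is a branching bisimulation, except that it need not be transitive:
inert steps have to be matched by staying put. -/
structure IsBranchingTransfer (τ : A) (tr : Q → A → PMF Q → Prop) (W : Q → Q → Prop) : Prop where
  symm : ∀ s t, W s t → W t s
  transfer : ∀ s t, W s t → ∀ a π, tr s a π →
    (a = τ ∧ ∀ s' ∈ π.support, W s' t) ∨
    ∃ t' π', TauPath τ tr W s t t' ∧ tr t' a π' ∧ LiftRel W π π'

open Relation in
theorem IsBranchingTransfer.simulate_path {W : Q → Q → Prop} (hW : IsBranchingTransfer τ tr W)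
    {s t t' : Q} (hp : TauPath τ tr (ReflTransGen W) s t t') {u : Q} (hu : W t u) :
    ∃ u', TauPath τ tr (ReflTransGen W) s u u' ∧ W t' u' := by
  induction hp generalizing u with
  | nil hB => exact ⟨u, .nil (hB.tail hu), hu⟩
  | @cons t t₁ t' π hB htr hπ ht₁ _ ih =>
    rcases hW.transfer t u hu τ π htr with ⟨-, hin⟩ | ⟨u₀, π₀, hpath, htr₀, hlift⟩
    -- The step is answered by waiting at `u`.
    · exact ih (hin _ ht₁)
    · obtain ⟨u₁, hu₁, hW₁⟩ := hlift.exists_right ht₁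
      obtain ⟨u', hp', hu'⟩ := ih hW₁
      refine ⟨u', (hpath.mono fun v hv => hB.tail hv).trans
        (.cons (hB.tail hpath.rel_last) htr₀ (liftRel_pure_left.2 fun v hv => ?_) hu₁ hp'), hu'⟩
      obtain ⟨x, hx, hxv⟩ := hlift.exists_left hv
      exact (liftRel_pure_left.1 hπ x hx).tail hxv

open Relation in
-- The matching is carried along the chain of `W`-steps from `s` to `t`: at each link the path found
-- so far is simulated, and then its final transition is matched.
theorem IsBranchingTransfer.isBranchingBisim {W : Q → Q → Prop}
    (hW : IsBranchingTransfer τ tr W) : IsBranchingBisim τ tr (ReflTransGen W) := by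
  have hsymm : ∀ s t, ReflTransGen W s t → ReflTransGen W t s :=
    fun s t h => by
      induction h with
      | refl => exact .refl
      | tail _ h ih => exact .head (hW.symm _ _ h) ih
  refine ⟨⟨fun _ => .refl, fun h => hsymm _ _ h, fun h h' => h.trans h'⟩, ?_⟩
  intro s t hst a π htr
  induction hst with
  | refl => exact .inr ⟨s, π, .nil .refl, htr, LiftRel.refl (fun _ => .refl) π⟩
  | @tail t u hst htu ih =>
    rcases ih with hin | ⟨t', π', hpath, htr', hlift⟩
    · exact .inl hin
    · obtain ⟨u₁, hp₁, hW₁⟩ := hW.simulate_path hpath htu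
      rcases hW.transfer t' u₁ hW₁ a π' htr' with ⟨ha, hin⟩ | ⟨u₂, π₂, hp₂, htr₂, hl₂⟩
      · refine .inl ⟨ha, liftRel_pure_left.2 fun v hv => ?_⟩
        obtain ⟨x, hx, hvx⟩ := hlift.exists_right hv
        exact hp₁.rel_last.trans (hsymm _ _ (hvx.tail (hin x hx)))
      · exact .inr ⟨u₂, π₂, hp₁.trans (hp₂.mono fun v hv => hpath.rel_last.tail hv), htr₂,
          hlift.comp (fun _ _ _ h h' => h.tail h') hl₂⟩

theorem IsBranchingTransfer.branchingBisimilar {W : Q → Q → Prop}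
    (hW : IsBranchingTransfer τ tr W) {s t : Q} (h : W s t) : BranchingBisimilar τ tr s t :=
  ⟨_, hW.isBranchingBisim, .single h⟩

variable (τ tr)

theorem BranchingBisimilar.isBranchingTransfer :
    IsBranchingTransfer τ tr (BranchingBisimilar τ tr) where
  symm := fun _ _ ⟨B, hB, h⟩ => ⟨B, hB, hB.1.symm h⟩
  transfer := by
    rintro s t ⟨B, hB, h⟩ a π htr
    rcases hB.2 s t h a π htr with ⟨ha, hin⟩ | ⟨t', π', hpath, htr', hlift⟩
    · exact .inl ⟨ha, fun s' hs' =>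
        ⟨B, hB, hB.1.trans (hB.1.symm (liftRel_pure_left.1 hin s' hs')) h⟩⟩
    · exact .inr ⟨t', π', hpath.mono fun u hu => ⟨B, hB, hu⟩, htr',
        hlift.mono fun _ _ hu => ⟨B, hB, hu⟩⟩

/-- Transitivity holds because the reflexive-transitive closure of bisimilarity is itself a
branching bisimulation. -/
theorem BranchingBisimilar.equivalence : Equivalence (BranchingBisimilar τ tr) := by
  have h := (BranchingBisimilar.isBranchingTransfer τ tr).isBranchingBisim
  exact ⟨fun s => ⟨_, h, .refl⟩, fun hst => (BranchingBisimilar.isBranchingTransfer τ tr).symm _ _ hst,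
    fun hst htu => ⟨_, h, .tail (.single hst) htu⟩⟩

theorem RootedBranchingBisimilar.isRootedBranchingBisim :
    IsRootedBranchingBisim τ tr (RootedBranchingBisimilar τ tr) := by
  refine ⟨fun s t ⟨E, hE, h⟩ => ⟨E, hE, hE.1 _ _ h⟩, ?_⟩
  rintro s t ⟨E, hE, h⟩ a π htr
  exact hE.2 s t h a π htr

theorem RootedBranchingBisimilar.equivalence : Equivalence (RootedBranchingBisimilar τ tr) := by
  have hb := BranchingBisimilar.equivalence τ tr
  have hr := RootedBranchingBisimilar.isRootedBranchingBisim τ tr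
  refine ⟨fun s => ⟨Eq, ⟨fun _ _ h => h.symm, ?_⟩, rfl⟩, fun h => hr.1 _ _ h,
    fun {s t u} hst htu =>
      ⟨fun x z => ∃ y, RootedBranchingBisimilar τ tr x y ∧ RootedBranchingBisimilar τ tr y z,
        ⟨?_, ?_⟩, t, hst, htu⟩⟩
  · rintro s _ rfl a π h
    exact ⟨π, h, LiftRel.refl hb.refl π⟩
  · rintro x z ⟨y, hxy, hyz⟩
    exact ⟨y, hr.1 _ _ hyz, hr.1 _ _ hxy⟩
  · rintro x z ⟨y, hxy, hyz⟩ a π h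
    obtain ⟨π', h', hl⟩ := hr.2 x y hxy a π h
    obtain ⟨π'', h'', hl'⟩ := hr.2 y z hyz a π' h'
    exact ⟨π'', h'', (LiftRel.equivalence hb).trans hl hl'⟩

end Branching

/-! ### Variables, contexts and substitutions -/

section Terms

variable {S : Signature.{u}} {X : Srt → Type v} {A : Type w}

theorem Term.subst_congr {Y : Srt → Type*} {ρ ρ' : Subst S X Y} {σ : Srt} (t : Term S X σ)
    (h : ∀ κ (z : X κ), (⟨κ, z⟩ : Σ σ : Srt, X σ) ∈ t.vars → ρ κ z = ρ' κ z) :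
    t.subst ρ = t.subst ρ' := by
  induction t with
  | var x => exact h _ x rfl
  | app f args ih =>
    simp only [Term.subst]
    exact congrArg _ (funext fun i => ih i fun κ z hz => h κ z ⟨i, hz⟩)
  | lift f args ih =>
    simp only [Term.subst]
    exact congrArg _ (funext fun i => ih i fun κ z hz => h κ z ⟨i, hz⟩)
  | dirac hd t ih =>
    simp only [Term.subst]
    exact congrArg _ (ih h)
  | mix p hp args ih =>
    simp only [Term.subst]
    exact congrArg _ (funext fun i => ih i fun κ z hz => h κ z ⟨i, hz⟩)

theorem Term.exists_fill_eq {κ : Srt} {z : X κ} {σ : Srt} (t : Term S X σ)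
    (h : (⟨κ, z⟩ : Σ σ : Srt, X σ) ∈ t.vars) : ∃ C : Ctx S X κ σ, C.fill (.var z) = t := by
  induction t with
  | var x => cases h; exact ⟨.hole, rfl⟩
  | app f args ih =>
    obtain ⟨i, hi⟩ := h
    obtain ⟨C, hC⟩ := ih i hi
    exact ⟨.app f i C args, by simp [Ctx.fill, hC]⟩
  | lift f args ih =>
    obtain ⟨i, hi⟩ := h
    obtain ⟨C, hC⟩ := ih i hi
    exact ⟨.lift f i C args, by simp [Ctx.fill, hC]⟩
  | dirac hd t ih =>
    obtain ⟨C, hC⟩ := ih h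
    exact ⟨.dirac hd C, by simp [Ctx.fill, hC]⟩
  | mix p hp args ih =>
    obtain ⟨i, hi⟩ := h
    obtain ⟨C, hC⟩ := ih i hi
    exact ⟨.mix p hp i C args, by simp [Ctx.fill, hC]⟩

theorem Ctx.mem_vars_fill {κ : Srt} (z : X κ) {σ : Srt} (C : Ctx S X κ σ) :
    (⟨κ, z⟩ : Σ σ : Srt, X σ) ∈ (C.fill (.var z)).vars := by
  induction C with
  | hole => exact rfl
  | app f i C args ih => exact ⟨i, by simpa using ih⟩
  | lift f i C args ih => exact ⟨i, by simpa using ih⟩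
  | dirac hd C ih => exact ih
  | mix p hp i C args ih => exact ⟨i, by simpa using ih⟩

theorem IsBar.vars_eq {σ : Srt} {z : X σ} {θ : Term S X Srt.d} (h : IsBar z θ) :
    θ.vars = {⟨σ, z⟩} := by
  cases h <;> rfl

theorem Ctx.wNested_of_fill_eq_var {P : PTSS S X A} {κ σ : Srt} {u : Term S X κ} {z : X σ}
    (C : Ctx S X κ σ) (h : C.fill u = .var z) : C.WNested P := by
  cases C with
  | hole => trivial
  | app => cases h
  | lift => cases h
  | dirac => cases h
  | mix => cases h

theorem IsBar.wNested_of_fill_eq {P : PTSS S X A} {κ σ : Srt} {z : X σ} {u : Term S X κ}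
    {θ : Term S X Srt.d} (h : IsBar z θ) (C : Ctx S X κ Srt.d) (hC : C.fill u = θ) :
    C.WNested P := by
  cases h with
  | dist μ => exact C.wNested_of_fill_eq_var hC
  | state x hd =>
    cases C with
    | hole => trivial
    | lift => cases hC
    | dirac hd C =>
      injection hC with hC
      exact C.wNested_of_fill_eq_var (P := P) hC
    | mix => cases hC

/-- A substitution can be redefined on pairwise different variables. -/
theorem exists_subst_eq {Y : Srt → Type*} {f : S.Op} {ζ : ∀ i : Fin (S.rk f), X (S.ar f i)}
    (hζ : AllDifferent ζ) (ξ : ∀ i, Term S Y (S.ar f i)) (ρ : Subst S X Y) :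
    ∃ ρ' : Subst S X Y, (∀ i, ρ' _ (ζ i) = ξ i) ∧
      ∀ σ (z : X σ), ¬ IsOneOf z ζ → ρ' σ z = ρ σ z := by
  -- Working with pairs of a sort and a variable allows variables of a priori different sorts to be
  -- compared; the values are then compared by `HEq`.
  have h : ∀ p : Σ σ : Srt, X σ, ∃ u : Term S Y p.1,
      (∀ i, (⟨S.ar f i, ζ i⟩ : Σ σ : Srt, X σ) = p → HEq u (ξ i)) ∧
      (¬ IsOneOf p.2 ζ → u = ρ p.1 p.2) := by
    intro p
    by_cases hp : IsOneOf p.2 ζ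
    · obtain ⟨i, hi⟩ := hp
      obtain rfl : (⟨S.ar f i, ζ i⟩ : Σ σ : Srt, X σ) = p := hi
      exact ⟨ξ i, fun j hj => by rw [hζ _ _ hj], fun hn => (hn ⟨i, rfl⟩).elim⟩
    · exact ⟨ρ p.1 p.2, fun i hi => (hp ⟨i, hi⟩).elim, fun _ => rfl⟩
  choose g hg₁ hg₂ using h
  exact ⟨fun σ z => g ⟨σ, z⟩, fun i => eq_of_heq (hg₁ _ i rfl), fun σ z hz => hg₂ ⟨σ, z⟩ hz⟩

end Terms

/-! ### Provability and stable models -/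

section Models

variable {S : Signature.{u}} {X : Srt → Type v} {A : Type w}

theorem Provable.mono {Y : Srt → Type*} {P : PTSS S X A} {H H' : Set (Literal S Y A)}
    (h : H ⊆ H') {ψ : Literal S Y A} (hψ : Provable P H ψ) : Provable P H' ψ := by
  induction hψ with
  | hyp χ hχ => exact .hyp χ (h hχ)
  | rule r hr ρ _ ih => exact .rule r hr ρ ih

/-- The negative literals that hold in a transition relation. -/
def negativeTheory (Tr : TransRel S A) : Set (Literal S (fun _ => Empty) A) :=
  {φ | φ.IsNegative ∧ Holds Tr φ}

theorem supported_iff {P : PTSS S X A} {Tr : TransRel S A} {t : Closed S Srt.s} {a : A}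
    {θ : Closed S Srt.d} :
    Supported P Tr t a θ ↔ Provable P (negativeTheory Tr) (.pos t a θ) :=
  ⟨fun ⟨N, hneg, hpr, hold⟩ =>
      hpr.mono (show N ⊆ negativeTheory Tr from fun φ hφ => ⟨hneg φ hφ, hold φ hφ⟩),
    fun h => ⟨_, fun _ hφ => hφ.1, h, fun _ hφ => hφ.2⟩⟩

theorem supported_anti (P : PTSS S X A) {Tr Tr' : TransRel S A} (h : Tr ≤ Tr') :
    Supported P Tr' ≤ Supported P Tr := by
  rintro t a θ ⟨N, hneg, hpr, hold⟩
  refine ⟨N, hneg, hpr, fun φ hφ => ?_⟩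
  cases φ with
  | pos => exact (hneg _ hφ).elim
  | neg t b => exact fun θ' hθ' => hold _ hφ θ' (h _ _ _ hθ')

theorem provable_neg_iff {P : PTSS S X A} {Tr : TransRel S A} {t : Closed S Srt.s} {b : A} :
    Provable P (negativeTheory Tr) (.neg t b) ↔ ∀ θ, ¬ Tr t b θ := by
  refine ⟨fun h => ?_, fun h =>
    .hyp _ (show Literal.neg t b ∈ negativeTheory Tr from ⟨trivial, h⟩)⟩
  generalize hψ : Literal.neg t b = ψ at h
  cases h with
  | hyp _ hχ => subst hψ; exact hχ.2
  | rule r hr ρ hprem => cases hψ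

/-- The last rule of a proof of a transition. -/
theorem Supported.exists_rule {P : PTSS S X A} {Tr : TransRel S A} {t : Closed S Srt.s} {a : A}
    {θ : Closed S Srt.d} (h : Supported P Tr t a θ) :
    ∃ r ∈ P, ∃ ρ : Subst S X fun _ => Empty, r.src.subst ρ = t ∧ r.act = a ∧ r.tgt.subst ρ = θ ∧
      ∀ φ ∈ r.prem, Provable P (negativeTheory Tr) (φ.subst ρ) := by
  rw [supported_iff] at h
  generalize hψ : Literal.pos t a θ = ψ at h
  cases h with
  | hyp _ hχ => subst hψ; exact hχ.1.elim
  | rule r hr ρ hprem =>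
    injection hψ with h₁ h₂ h₃
    exact ⟨r, hr, ρ, h₁.symm, h₂.symm, h₃.symm, hprem⟩

theorem IsStableModel.supported_eq {P : PTSS S X A} {Tr : TransRel S A}
    (h : IsStableModel P Tr Tr) : Supported P Tr = Tr := by
  funext t a θ
  exact propext (h.certain t a θ).symm

/-- The monotone operator on transition relations whose least fixed point is the certain part of
the least 3-valued stable model. -/
def supportedSq (P : PTSS S X A) : TransRel S A →o TransRel S A where
  toFun CT := Supported P (Supported P CT)
  monotone' _ _ h := supported_anti P (supported_anti P h)

/-- Induction over the approximations of the least 3-valued stable model of a complete PTSS. -/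
theorem IsLeastStableModel.induction {P : PTSS S X A} {Tr : TransRel S A}
    (hTr : IsLeastStableModel P Tr Tr) {p : TransRel S A → Prop}
    (step : ∀ CT, CT ≤ Tr → p CT → p (Supported P (Supported P CT)))
    (hSup : ∀ s : Set (TransRel S A), (∀ CT ∈ s, p CT) → p (sSup s)) : p Tr := by
  have heq := hTr.1.supported_eq
  have hfix : supportedSq P Tr = Tr := by
    change Supported P (Supported P Tr) = Tr
    rw [heq, heq]
  have hle : (supportedSq P).lfp ≤ Tr := (supportedSq P).lfp_le hfix.le
  have hlfp : Supported P (Supported P (supportedSq P).lfp) = (supportedSq P).lfp :=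
    (supportedSq P).map_lfp
  -- The least fixed point is the certain part of a stable model, so leastness of `Tr` gives the
  -- reverse inclusion.
  have hmodel : IsStableModel P (supportedSq P).lfp (Supported P (supportedSq P).lfp) :=
    { le := fun t a θ h => supported_anti P hle t a θ (by rw [heq]; exact hle t a θ h)
      certain := fun t a θ => by rw [hlfp]
      possible := fun t a θ => Iff.rfl }
  have hge : Tr ≤ (supportedSq P).lfp := (hTr.2 _ _ hmodel).1
  rw [le_antisymm hge hle]
  exact OrderHom.lfp_induction _ (fun CT hCT hle' => step CT (hle'.trans hle) hCT) hSup

end Models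

/-! ### The shape of the rules in RBB safe specifications -/

section Rules

variable {S : Signature.{u}} {X : Srt → Type v} {A : Type w}

/-- The properties shared by patience rules for wild arguments and RBB safe rules. -/
structure IsNestedRule (P : PTSS S X A) (r : Rule S X A) (f : S.Op)
    (ζ : ∀ i : Fin (S.rk f), X (S.ar f i)) : Prop where
  src_eq : r.src = .app f (fun i => .var (ζ i))
  src_different : AllDifferent ζ
  target_var : ∀ t a θ, Literal.pos t a θ ∈ r.prem → ∃ μ : X Srt.d, θ = .var μ ∧ ¬ IsOneOf μ ζ
  target_different : ∀ t a t' a' (μ : X Srt.d), Literal.pos t a (.var μ) ∈ r.prem →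
    Literal.pos t' a' (.var μ) ∈ r.prem → t = t' ∧ a = a'
  target_nested : ∀ t a (μ : X Srt.d), Literal.pos t a (.var μ) ∈ r.prem → OnlyWNested P μ r.tgt
  wild_nested : ∀ i, Wild P f i → OnlyWNested P (ζ i) r.tgt
  no_lookahead : ∀ t a (μ : X Srt.d) t' a' θ', Literal.pos t a (.var μ) ∈ r.prem →
    Literal.pos t' a' θ' ∈ r.prem → (⟨Srt.d, μ⟩ : Σ σ : Srt, X σ) ∉ t'.vars

theorem IsRBBSafeRule.isNestedRule {τ : A} {P : PTSS S X A} {r : Rule S X A} {f : S.Op}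
    {ζ : ∀ i : Fin (S.rk f), X (S.ar f i)} (h : IsRBBSafeRule τ P r f ζ) : IsNestedRule P r f ζ :=
  ⟨h.src_eq, h.src_different, h.target_var, h.target_different, h.target_nested, h.wild_nested,
    h.no_lookahead⟩

/-- In the target, `μ` sits directly in the wild argument `i` of the lifting of `f`, and every other
variable stays in its own argument position, below at most a `δ`. So all required occurrences are
w-nested. -/
theorem IsPatienceRule.exists_isNestedRule {τ : A} {P : PTSS S X A} {r : Rule S X A} {f : S.Op}
    {i : Fin (S.rk f)} (hw : Wild P f i) (h : IsPatienceRule τ f i r) :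
    ∃ ζ, IsNestedRule P r f ζ := by
  obtain ⟨ζ, x, μ, θ, hζ, hμ, hx, hprem, hsrc, -, htgt, hi, hbar⟩ := h
  have key : ∀ t a θ, Literal.pos t a θ ∈ r.prem → t = .var x ∧ a = τ ∧ θ = .var μ := by
    intro t a θ h
    rw [hprem, Set.mem_singleton_iff] at h
    injection h with h₁ h₂ h₃
    exact ⟨h₁, h₂, h₃⟩
  have hfill : ∀ {κ : Srt} (z : X κ) (C : Ctx S X κ Srt.d), C.fill (.var z) = .lift f θ →
      (∃ j, j ≠ i ∧ (⟨κ, z⟩ : Σ σ : Srt, X σ) = ⟨S.ar f j, ζ j⟩ ∧ (Wild P f j → C.WNested P)) ∨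
      ((⟨κ, z⟩ : Σ σ : Srt, X σ) = ⟨Srt.d, μ⟩ ∧ C.WNested P) := by
    intro κ z C hC
    cases C with
    | hole => cases hC
    | dirac => cases hC
    | mix => cases hC
    | lift g j C args =>
      injection hC with hg hargs
      subst hg
      have hj : C.fill (.var z) = θ j := by
        have := congrFun (eq_of_heq hargs) j
        simpa using this
      have hz := C.mem_vars_fill z
      rw [hj] at hz
      rcases eq_or_ne j i with rfl | hji
      · rw [hi] at hj hz
        exact .inr ⟨hz, hw, C.wNested_of_fill_eq_var hj⟩
      · have hb := hbar j hji
        rw [hb.vars_eq] at hz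
        exact .inl ⟨j, hji, hz, fun hwj => ⟨hwj, hb.wNested_of_fill_eq C hj⟩⟩
  refine ⟨ζ, hsrc, hζ, ?_, ?_, ?_, ?_, ?_⟩
  · intro t a θ h
    exact ⟨μ, (key _ _ _ h).2.2, hμ⟩
  · intro t a t' a' μ' h h'
    obtain ⟨rfl, rfl, -⟩ := key _ _ _ h
    obtain ⟨rfl, rfl, -⟩ := key _ _ _ h'
    exact ⟨rfl, rfl⟩
  · intro t a μ' h C hC
    obtain ⟨-, -, h⟩ := key _ _ _ h
    injection h with _ h
    subst h
    rw [htgt] at hC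
    rcases hfill _ C hC with ⟨j, -, hj, -⟩ | ⟨-, h⟩
    · exact (hμ ⟨j, hj.symm⟩).elim
    · exact h
  · intro j hwj C hC
    rw [htgt] at hC
    rcases hfill _ C hC with ⟨k, -, hk, h⟩ | ⟨-, h⟩
    · rw [hζ _ _ hk] at hwj
      exact h hwj
    · exact h
  · intro t a μ' t' a' θ' h h' hmem
    obtain ⟨rfl, -, -⟩ := key _ _ _ h'
    cases hmem

theorem IsRBBSafe.exists_isNestedRule {τ : A} {P : PTSS S X A} (hP : IsRBBSafe τ P)
    {r : Rule S X A} (hr : r ∈ P) : ∃ f ζ, IsNestedRule P r f ζ := by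
  rcases hP r hr with ⟨f, i, hw, h⟩ | ⟨f, ζ, h⟩
  · exact ⟨f, h.exists_isNestedRule hw⟩
  · exact ⟨f, ζ, h.isNestedRule⟩

/-- Application of a rule under a substitution for the variables in the source of the conclusion.
The targets of the positive premises are chosen subject to the constraint `q`. -/
theorem IsNestedRule.exists_supported {P : PTSS S X A} {r : Rule S X A} {f : S.Op}
    {ζ : ∀ i : Fin (S.rk f), X (S.ar f i)} (h : IsNestedRule P r f ζ) (hr : r ∈ P)
    {N : TransRel S A} (ρ : Subst S X fun _ => Empty) (q : X Srt.d → Closed S Srt.d → Prop)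
    (hpos : ∀ t a μ, Literal.pos t a (.var μ) ∈ r.prem →
      ∃ θ, Supported P N (t.subst ρ) a θ ∧ q μ θ)
    (hneg : ∀ t b, Literal.neg t b ∈ r.prem → ∀ ρ' : Subst S X fun _ => Empty,
      (∀ x, ρ' Srt.s x = ρ Srt.s x) → ∀ θ, ¬ N (t.subst ρ') b θ) :
    ∃ ρ' : Subst S X fun _ => Empty, (∀ x, ρ' Srt.s x = ρ Srt.s x) ∧
      (∀ μ, (∃ t a, Literal.pos t a (.var μ) ∈ r.prem ∧ q μ (ρ' Srt.d μ)) ∨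
        ρ' Srt.d μ = ρ Srt.d μ) ∧
      Supported P N (r.src.subst ρ) r.act (r.tgt.subst ρ') := by
  -- A single choice for `μ` serves, since different positive premises have different targets.
  have hch : ∀ μ : X Srt.d, ∃ θ : Closed S Srt.d,
      (∀ t a, Literal.pos t a (.var μ) ∈ r.prem → Supported P N (t.subst ρ) a θ ∧ q μ θ) ∧
      ((∀ t a, Literal.pos t a (.var μ) ∉ r.prem) → θ = ρ Srt.d μ) := by
    intro μ
    by_cases hμ : ∃ t a, Literal.pos t a (.var μ) ∈ r.prem
    · obtain ⟨t, a, hta⟩ := hμ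
      obtain ⟨θ, hθ⟩ := hpos t a μ hta
      refine ⟨θ, fun t' a' h' => ?_, fun hn => (hn t a hta).elim⟩
      obtain ⟨rfl, rfl⟩ := h.target_different _ _ _ _ _ hta h'
      exact hθ
    · push Not at hμ
      exact ⟨ρ Srt.d μ, fun t a hta => (hμ t a hta).elim, fun _ => rfl⟩
  choose g hg₁ hg₂ using hch
  let ρ' : Subst S X fun _ => Empty := fun σ => match σ with
    | .s => ρ Srt.s
    | .d => g
  have hagree : ∀ σ (z : X σ), (∀ t a μ, Literal.pos t a (.var μ) ∈ r.prem →
      (⟨Srt.d, μ⟩ : Σ σ : Srt, X σ) ≠ ⟨σ, z⟩) → ρ' σ z = ρ σ z := by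
    intro σ z hz
    cases σ with
    | s => rfl
    | d => exact hg₂ z fun t a hta => hz t a z hta rfl
  have hsrc : r.src.subst ρ' = r.src.subst ρ := by
    refine r.src.subst_congr fun κ z hz => hagree κ z fun t a μ hta heq => ?_
    obtain ⟨μ', hμ', hnot⟩ := h.target_var _ _ _ hta
    injection hμ' with _ hμ'
    subst hμ'
    rw [h.src_eq, ← heq] at hz
    obtain ⟨i, hi⟩ := hz
    exact hnot ⟨i, (Set.mem_singleton_iff.1 hi).symm⟩
  refine ⟨ρ', fun _ => rfl, fun μ => ?_, ?_⟩
  · by_cases hμ : ∃ t a, Literal.pos t a (.var μ) ∈ r.prem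
    · obtain ⟨t, a, hta⟩ := hμ
      exact .inl ⟨t, a, hta, (hg₁ μ t a hta).2⟩
    · push Not at hμ
      exact .inr (hg₂ μ hμ)
  · rw [supported_iff, ← hsrc]
    refine Provable.rule r hr ρ' fun φ hφ => ?_
    cases φ with
    -- Premise targets may occur in the source of a negative premise, and `ρ'` has changed them.
    -- Hence `hneg` quantifies over all substitutions that agree with `ρ` on state variables.
    | neg t b => exact provable_neg_iff.2 (hneg t b hφ ρ' fun _ => rfl)
    | pos t a θ =>
      obtain ⟨μ, rfl, -⟩ := h.target_var _ _ _ hφ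
      -- By the absence of look-ahead, the new values of the premise targets do not affect the
      -- sources of positive premises.
      have hst : t.subst ρ' = t.subst ρ := by
        refine t.subst_congr fun κ z hz => hagree κ z fun t' a' μ' hta heq => ?_
        rw [← heq] at hz
        exact h.no_lookahead _ _ _ _ _ _ hta hφ hz
      change Provable P _ (.pos (t.subst ρ') a (g μ))
      rw [hst, ← supported_iff]
      exact (hg₁ μ t a hφ).1

end Rules

/-! ### Closures of relations under operators -/

section Closures

variable {S : Signature.{u}} {X : Srt → Type v} {A : Type w}

/-- The closure of a relation on closed terms under all operators. -/
inductive CongClosure (E : (σ : Srt) → Closed S σ → Closed S σ → Prop) :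
    (σ : Srt) → Closed S σ → Closed S σ → Prop
  | base {σ : Srt} {ξ ξ' : Closed S σ} (h : E σ ξ ξ') : CongClosure E σ ξ ξ'
  | app (f : S.Op) (ξ ξ' : ∀ i : Fin (S.rk f), Closed S (S.ar f i))
      (h : ∀ i, CongClosure E (S.ar f i) (ξ i) (ξ' i)) :
      CongClosure E Srt.s (.app f ξ) (.app f ξ')
  | lift (f : S.Op) (θ θ' : Fin (S.rk f) → Closed S Srt.d)
      (h : ∀ i, CongClosure E Srt.d (θ i) (θ' i)) :
      CongClosure E Srt.d (.lift f θ) (.lift f θ')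
  | dirac (hd : S.hasDirac) (t t' : Closed S Srt.s) (h : CongClosure E Srt.s t t') :
      CongClosure E Srt.d (.dirac hd t) (.dirac hd t')
  | mix {n : ℕ} (p : PMF (Fin n)) (hp : p ∈ S.mixes n) (θ θ' : Fin n → Closed S Srt.d)
      (h : ∀ i, CongClosure E Srt.d (θ i) (θ' i)) :
      CongClosure E Srt.d (.mix p hp θ) (.mix p hp θ')

/-- The closure of the relations `F` and `R` under all operators, where only `R` is allowed in tame
arguments. -/
inductive WildClosure (P : PTSS S X A) (R F : (σ : Srt) → Closed S σ → Closed S σ → Prop) :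
    (σ : Srt) → Closed S σ → Closed S σ → Prop
  | base {σ : Srt} {ξ ξ' : Closed S σ} (h : F σ ξ ξ') : WildClosure P R F σ ξ ξ'
  | tame {σ : Srt} {ξ ξ' : Closed S σ} (h : R σ ξ ξ') : WildClosure P R F σ ξ ξ'
  | app (f : S.Op) (ξ ξ' : ∀ i : Fin (S.rk f), Closed S (S.ar f i))
      (hw : ∀ i, Wild P f i → WildClosure P R F (S.ar f i) (ξ i) (ξ' i))
      (ht : ∀ i, ¬ Wild P f i → R (S.ar f i) (ξ i) (ξ' i)) :
      WildClosure P R F Srt.s (.app f ξ) (.app f ξ')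
  | lift (f : S.Op) (θ θ' : Fin (S.rk f) → Closed S Srt.d)
      (hw : ∀ i, Wild P f i → WildClosure P R F Srt.d (θ i) (θ' i))
      (ht : ∀ i, ¬ Wild P f i → R Srt.d (θ i) (θ' i)) :
      WildClosure P R F Srt.d (.lift f θ) (.lift f θ')
  | dirac (hd : S.hasDirac) (t t' : Closed S Srt.s) (h : WildClosure P R F Srt.s t t') :
      WildClosure P R F Srt.d (.dirac hd t) (.dirac hd t')
  | mix {n : ℕ} (p : PMF (Fin n)) (hp : p ∈ S.mixes n) (θ θ' : Fin n → Closed S Srt.d)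
      (h : ∀ i, WildClosure P R F Srt.d (θ i) (θ' i)) :
      WildClosure P R F Srt.d (.mix p hp θ) (.mix p hp θ')

/-- The closure of a relation on closed state terms under the operators of sort `s`, with no
constraint on the arguments of sort `d`: the latter have no influence on the initial actions. -/
inductive InitClosure (E : Closed S Srt.s → Closed S Srt.s → Prop) :
    (σ : Srt) → Closed S σ → Closed S σ → Prop
  | dist (θ θ' : Closed S Srt.d) : InitClosure E Srt.d θ θ'
  | base {t t' : Closed S Srt.s} (h : E t t') : InitClosure E Srt.s t t'
  | app (f : S.Op) (ξ ξ' : ∀ i : Fin (S.rk f), Closed S (S.ar f i))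
      (h : ∀ i, InitClosure E (S.ar f i) (ξ i) (ξ' i)) :
      InitClosure E Srt.s (.app f ξ) (.app f ξ')

variable {E R F : (σ : Srt) → Closed S σ → Closed S σ → Prop} {P : PTSS S X A}

theorem CongClosure.symm (hE : ∀ σ ξ ξ', E σ ξ ξ' → E σ ξ' ξ) {σ : Srt} {ξ ξ' : Closed S σ}
    (h : CongClosure E σ ξ ξ') : CongClosure E σ ξ' ξ := by
  induction h with
  | base h => exact .base (hE _ _ _ h)
  | app f ξ ξ' _ ih => exact .app f _ _ ih
  | lift f θ θ' _ ih => exact .lift f _ _ ih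
  | dirac hd t t' _ ih => exact .dirac hd _ _ ih
  | mix p hp θ θ' _ ih => exact .mix p hp _ _ ih

theorem WildClosure.symm (hR : ∀ σ ξ ξ', R σ ξ ξ' → R σ ξ' ξ) (hF : ∀ σ ξ ξ', F σ ξ ξ' → F σ ξ' ξ)
    {σ : Srt} {ξ ξ' : Closed S σ} (h : WildClosure P R F σ ξ ξ') : WildClosure P R F σ ξ' ξ := by
  induction h with
  | base h => exact .base (hF _ _ _ h)
  | tame h => exact .tame (hR _ _ _ h)
  | app f ξ ξ' _ ht ih => exact .app f _ _ ih fun i hi => hR _ _ _ (ht i hi)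
  | lift f θ θ' _ ht ih => exact .lift f _ _ ih fun i hi => hR _ _ _ (ht i hi)
  | dirac hd t t' _ ih => exact .dirac hd _ _ ih
  | mix p hp θ θ' _ ih => exact .mix p hp _ _ ih

theorem InitClosure.symm {E : Closed S Srt.s → Closed S Srt.s → Prop}
    (hE : ∀ t t', E t t' → E t' t) {σ : Srt} {ξ ξ' : Closed S σ} (h : InitClosure E σ ξ ξ') :
    InitClosure E σ ξ' ξ := by
  induction h with
  | dist => exact .dist _ _
  | base h => exact .base (hE _ _ h)
  | app f ξ ξ' _ ih => exact .app f _ _ ih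

theorem CongClosure.initClosure {σ : Srt} {ξ ξ' : Closed S σ} (h : CongClosure E σ ξ ξ') :
    InitClosure (E Srt.s) σ ξ ξ' := by
  induction h with
  | @base σ _ _ h =>
    cases σ with
    | s => exact .base h
    | d => exact .dist _ _
  | app f ξ ξ' _ ih => exact .app f _ _ ih
  | lift => exact .dist _ _
  | dirac => exact .dist _ _
  | mix => exact .dist _ _

theorem CongClosure.subst {ρ ρ' : Subst S X fun _ => Empty} {σ : Srt} (t : Term S X σ)
    (h : ∀ κ (z : X κ), (⟨κ, z⟩ : Σ σ : Srt, X σ) ∈ t.vars → CongClosure E κ (ρ κ z) (ρ' κ z)) :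
    CongClosure E σ (t.subst ρ) (t.subst ρ') := by
  induction t with
  | var x => exact h _ x rfl
  | app f args ih => exact .app f _ _ fun i => ih i fun κ z hz => h κ z ⟨i, hz⟩
  | lift f args ih => exact .lift f _ _ fun i => ih i fun κ z hz => h κ z ⟨i, hz⟩
  | dirac hd t ih => exact .dirac hd _ _ (ih h)
  | mix p hp args ih => exact .mix p hp _ _ fun i => ih i fun κ z hz => h κ z ⟨i, hz⟩

theorem InitClosure.subst {E : Closed S Srt.s → Closed S Srt.s → Prop}
    {ρ ρ' : Subst S X fun _ => Empty} {σ : Srt} (t : Term S X σ)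
    (h : ∀ x : X Srt.s, (⟨Srt.s, x⟩ : Σ σ : Srt, X σ) ∈ t.vars →
      InitClosure E Srt.s (ρ Srt.s x) (ρ' Srt.s x)) :
    InitClosure E σ (t.subst ρ) (t.subst ρ') := by
  induction t with
  | @var σ x =>
    cases σ with
    | s => exact h x rfl
    | d => exact .dist _ _
  | app f args ih => exact .app f _ _ fun i => ih i fun x hx => h x ⟨i, hx⟩
  | lift => exact .dist _ _
  | dirac => exact .dist _ _
  | mix => exact .dist _ _

/-- Variables that are only related by the wild closure have to be w-nested. -/
theorem WildClosure.subst {ρ ρ' : Subst S X fun _ => Empty} {σ : Srt} (t : Term S X σ)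
    (h : ∀ κ (z : X κ), (⟨κ, z⟩ : Σ σ : Srt, X σ) ∈ t.vars →
      CongClosure E κ (ρ κ z) (ρ' κ z) ∨
      WildClosure P (CongClosure E) F κ (ρ κ z) (ρ' κ z) ∧
        ∀ C : Ctx S X κ σ, C.fill (.var z) = t → C.WNested P) :
    WildClosure P (CongClosure E) F σ (t.subst ρ) (t.subst ρ') := by
  induction t with
  | var x => exact (h _ x rfl).elim .tame fun h => h.1
  | app f args ih =>
    refine .app f _ _ (fun i _ => ih i fun κ z hz => ?_) fun i hi =>
      CongClosure.subst _ fun κ z hz => ?_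
    · refine (h κ z ⟨i, hz⟩).imp_right fun h' => ⟨h'.1, fun C hC => ?_⟩
      exact (h'.2 (.app f i C args) (by simp [Ctx.fill, hC])).2
    · refine (h κ z ⟨i, hz⟩).elim id fun h' => ?_
      obtain ⟨C, hC⟩ := (args i).exists_fill_eq hz
      exact (hi (h'.2 (.app f i C args) (by simp [Ctx.fill, hC])).1).elim
  | lift f args ih =>
    refine .lift f _ _ (fun i _ => ih i fun κ z hz => ?_) fun i hi =>
      CongClosure.subst _ fun κ z hz => ?_
    · refine (h κ z ⟨i, hz⟩).imp_right fun h' => ⟨h'.1, fun C hC => ?_⟩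
      exact (h'.2 (.lift f i C args) (by simp [Ctx.fill, hC])).2
    · refine (h κ z ⟨i, hz⟩).elim id fun h' => ?_
      obtain ⟨C, hC⟩ := (args i).exists_fill_eq hz
      exact (hi (h'.2 (.lift f i C args) (by simp [Ctx.fill, hC])).1).elim
  | dirac hd t ih =>
    refine .dirac hd _ _ (ih fun κ z hz => ?_)
    refine (h κ z hz).imp_right fun h' => ⟨h'.1, fun C hC => ?_⟩
    exact h'.2 (.dirac hd C) (by simp [Ctx.fill, hC])
  | mix p hp args ih =>
    refine .mix p hp _ _ fun i => ih i fun κ z hz => ?_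
    refine (h κ z ⟨i, hz⟩).imp_right fun h' => ⟨h'.1, fun C hC => ?_⟩
    exact h'.2 (.mix p hp i C args) (by simp [Ctx.fill, hC])

/-! ### Semantics of related distribution terms -/

theorem liftRel_argLaw {σ : Srt} {θ θ' : Closed S Srt.d} (h : R Srt.d θ θ')
    {π π' : PMF (Closed S Srt.s)} (hπ : LiftRel (R Srt.s) π π') :
    LiftRel (R σ) (argLaw σ θ π) (argLaw σ θ' π') := by
  cases σ with
  | s => exact hπ
  | d => exact liftRel_pure_pure h

/-- The closure is respected because each distribution operator acts on couplings: liftings by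
products and images, mixtures by binding. -/
theorem CongClosure.liftRel_sem
    (hE : ∀ θ θ', E Srt.d θ θ' → LiftRel (E Srt.s) (sem θ) (sem θ')) {θ θ' : Closed S Srt.d}
    (h : CongClosure E Srt.d θ θ') : LiftRel (CongClosure E Srt.s) (sem θ) (sem θ') := by
  suffices H : ∀ σ (ξ ξ' : Closed S σ), CongClosure E σ ξ ξ' → σ = Srt.d →
      LiftRel (CongClosure E Srt.s) (sem ξ) (sem ξ') from H _ _ _ h rfl
  intro σ ξ ξ' h
  induction h with
  | base h => rintro rfl; exact (hE _ _ h).mono fun _ _ => .base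
  | app => exact fun h => nomatch h
  | lift f θ θ' h ih =>
    exact fun _ => LiftRel.map (Term.app f) (fun ξ ξ' => CongClosure.app f ξ ξ')
      (LiftRel.prod fun i => liftRel_argLaw (h i) (ih i rfl))
  | dirac hd t t' h _ => exact fun _ => liftRel_pure_pure h
  | mix p hp θ θ' _ ih => exact fun _ => LiftRel.bind p fun i => ih i rfl

theorem WildClosure.liftRel_sem
    (hR : ∀ θ θ', R Srt.d θ θ' → LiftRel (R Srt.s) (sem θ) (sem θ'))
    (hF : ∀ θ θ', F Srt.d θ θ' → LiftRel (F Srt.s) (sem θ) (sem θ')) {θ θ' : Closed S Srt.d}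
    (h : WildClosure P R F Srt.d θ θ') :
    LiftRel (WildClosure P R F Srt.s) (sem θ) (sem θ') := by
  suffices H : ∀ σ (ξ ξ' : Closed S σ), WildClosure P R F σ ξ ξ' → σ = Srt.d →
      LiftRel (WildClosure P R F Srt.s) (sem ξ) (sem ξ') from H _ _ _ h rfl
  intro σ ξ ξ' h
  induction h with
  | base h => rintro rfl; exact (hF _ _ h).mono fun _ _ => .base
  | tame h => rintro rfl; exact (hR _ _ h).mono fun _ _ => .tame
  | app => exact fun h => nomatch h
  | lift f θ θ' hw ht ih =>
    -- The coupling is built coordinatewise, for a relation that depends on whether the coordinate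
    -- is wild or tame.
    refine fun _ => LiftRel.map (Term.app f)
      (B := fun ξ ξ' => ∀ i, (Wild P f i → WildClosure P R F (S.ar f i) (ξ i) (ξ' i)) ∧
        (¬ Wild P f i → R (S.ar f i) (ξ i) (ξ' i)))
      (fun ξ ξ' h => WildClosure.app f ξ ξ' (fun i => (h i).1) fun i => (h i).2)
      (LiftRel.prod (B := fun i x y => (Wild P f i → WildClosure P R F (S.ar f i) x y) ∧
        (¬ Wild P f i → R (S.ar f i) x y)) fun i => ?_)
    by_cases hi : Wild P f i
    · exact (liftRel_argLaw (hw i hi) (ih i hi rfl)).mono fun _ _ h =>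
        ⟨fun _ => h, fun hn => (hn hi).elim⟩
    · exact (liftRel_argLaw (ht i hi) (hR _ _ (ht i hi))).mono fun _ _ h =>
        ⟨fun hy => (hi hy).elim, fun _ => h⟩
  | dirac hd t t' h _ => exact fun _ => liftRel_pure_pure h
  | mix p hp θ θ' _ ih => exact fun _ => LiftRel.bind p fun i => ih i rfl

/-- `θ` is `δ(ξ)` if `ξ` has sort `s`, and `ξ` itself if `ξ` has sort `d`. -/
inductive IsPointMass : {σ : Srt} → Closed S σ → Closed S Srt.d → Prop
  | state (t : Closed S Srt.s) (h : S.hasDirac) : IsPointMass t (.dirac h t)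
  | dist (θ : Closed S Srt.d) : IsPointMass θ θ

theorem IsBar.isPointMass {σ : Srt} {z : X σ} {θ : Term S X Srt.d} (h : IsBar z θ)
    (ρ : Subst S X fun _ => Empty) : IsPointMass (ρ σ z) (θ.subst ρ) := by
  cases h with
  | state x h => exact .state _ h
  | dist μ => exact .dist _

theorem IsPointMass.argLaw_eq {σ : Srt} {ξ : Closed S σ} {θ : Closed S Srt.d}
    (h : IsPointMass ξ θ) : argLaw σ θ (sem θ) = PMF.pure ξ := by
  cases h <;> rfl

theorem IsPointMass.congClosure {σ : Srt} {ξ ξ' : Closed S σ} {θ θ' : Closed S Srt.d}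
    (h : IsPointMass ξ θ) (h' : IsPointMass ξ' θ') (hξ : CongClosure E σ ξ ξ') :
    CongClosure E Srt.d θ θ' := by
  cases h with
  | state t hd => cases h'; exact .dirac hd _ _ hξ
  | dist => cases h'; exact hξ

theorem IsPointMass.wildClosure {σ : Srt} {ξ ξ' : Closed S σ} {θ θ' : Closed S Srt.d}
    (h : IsPointMass ξ θ) (h' : IsPointMass ξ' θ') (hξ : WildClosure P R F σ ξ ξ') :
    WildClosure P R F Srt.d θ θ' := by
  cases h with
  | state t hd => cases h'; exact .dirac hd _ _ hξ
  | dist => cases h'; exact hξ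

/-- A closed term whose sort is propositionally `s`, as a state term. -/
def toState {σ : Srt} (h : σ = Srt.s) (ξ : Closed S σ) : Closed S Srt.s := h ▸ ξ

/-- A closed state term as a term of a sort that is propositionally `s`. -/
def ofState {σ : Srt} (h : σ = Srt.s) (t : Closed S Srt.s) : Closed S σ := h ▸ t

theorem toState_ofState {σ : Srt} (h : σ = Srt.s) (t : Closed S Srt.s) :
    toState h (ofState h t) = t := by subst h; rfl

theorem ofState_toState {σ : Srt} (h : σ = Srt.s) (ξ : Closed S σ) :
    ofState h (toState h ξ) = ξ := by subst h; rfl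

theorem rel_toState_iff {σ : Srt} (h : σ = Srt.s) {ξ ξ' : Closed S σ} :
    R Srt.s (toState h ξ) (toState h ξ') ↔ R σ ξ ξ' := by subst h; rfl

theorem mem_support_argLaw {σ : Srt} (h : σ = Srt.s) {θ : Closed S Srt.d}
    {π : PMF (Closed S Srt.s)} {ξ : Closed S σ} :
    ξ ∈ (argLaw σ θ π).support ↔ toState h ξ ∈ π.support := by subst h; rfl

theorem exists_toState_subst {σ : Srt} {z : X σ} {x : X Srt.s}
    (h : (⟨σ, z⟩ : Σ σ : Srt, X σ) = ⟨Srt.s, x⟩) :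
    ∃ hσ : σ = Srt.s, ∀ ρ : Subst S X fun _ => Empty, toState hσ (ρ σ z) = ρ Srt.s x := by
  cases h
  exact ⟨rfl, fun _ => rfl⟩

/-- Point masses in all other coordinates freeze them, so a patience step only moves the `i`-th
argument. -/
theorem mem_support_sem_lift {f : S.Op} {i : Fin (S.rk f)} (hi : S.ar f i = Srt.s)
    {ξ : ∀ i : Fin (S.rk f), Closed S (S.ar f i)} {θ : Fin (S.rk f) → Closed S Srt.d}
    (hθ : ∀ j, j ≠ i → IsPointMass (ξ j) (θ j)) {t : Closed S Srt.s} :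
    t ∈ (sem (.lift f θ)).support ↔
      ∃ u ∈ (sem (θ i)).support, t = .app f (Function.update ξ i (ofState hi u)) := by
  simp only [sem, PMF.mem_support_map_iff, mem_support_prodPMF]
  constructor
  · rintro ⟨x, hx, rfl⟩
    refine ⟨toState hi (x i), (mem_support_argLaw hi).1 (hx i), congrArg _ (funext fun j => ?_)⟩
    rcases eq_or_ne j i with rfl | hj
    · rw [Function.update_self, ofState_toState]
    · have := hx j
      rw [(hθ j hj).argLaw_eq, PMF.support_pure, Set.mem_singleton_iff] at this
      rw [Function.update_of_ne hj, this]
  · rintro ⟨u, hu, rfl⟩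
    refine ⟨_, fun j => ?_, rfl⟩
    rcases eq_or_ne j i with rfl | hj
    · rw [Function.update_self, mem_support_argLaw hi, toState_ofState]
      exact hu
    · rw [Function.update_of_ne hj, (hθ j hj).argLaw_eq, PMF.support_pure]
      exact rfl

end Closures

section Congruence

variable {S : Signature.{u}} {X : Srt → Type v} {A : Type w} (τ : A) (P : PTSS S X A)
  (hP : IsComplete P)

/-! ### Initial actions -/

theorem assocRel_isLeast : IsLeastStableModel P (assocRel P hP) (assocRel P hP) := hP.choose_spec

theorem supported_assocRel : Supported P (assocRel P hP) = assocRel P hP :=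
  (assocRel_isLeast P hP).1.supported_eq

variable {P}

theorem IsNestedRule.src_subst {r : Rule S X A} {f : S.Op}
    {ζ : ∀ i : Fin (S.rk f), X (S.ar f i)} (h : IsNestedRule P r f ζ)
    (ρ : Subst S X fun _ => Empty) : r.src.subst ρ = .app f fun i => ρ _ (ζ i) := by
  rw [h.src_eq]
  rfl

/-- One half-step of the alternation between certain and possible transitions: positive premises
follow by induction on the proof, negative ones from the converse inclusion `hneg` between `N'` and
`N`. Arguments of sort `d` need not be related, because rules neither match on them nor constrain
the targets of their premises beyond being variables. -/
theorem InitClosure.exists_supported {E : Closed S Srt.s → Closed S Srt.s → Prop}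
    (hEr : ∀ t, E t t)
    (hE : ∀ s t a θ, E s t → assocRel P hP s a θ → ∃ θ', assocRel P hP t a θ')
    (hsafe : IsRBBSafe τ P) {N N' : TransRel S A} (hN : assocRel P hP ≤ N)
    (hN' : N' ≤ assocRel P hP)
    (hneg : ∀ s t b θ, InitClosure E Srt.s s t → N' t b θ → ∃ θ', N s b θ')
    {s t : Closed S Srt.s} {a : A} {θ : Closed S Srt.d} (h : Supported P N s a θ)
    (hst : InitClosure E Srt.s s t) : ∃ θ', Supported P N' t a θ' := by
  rw [supported_iff] at h
  generalize hψ : Literal.pos s a θ = ψ at h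
  induction h generalizing s t a θ with
  | hyp χ hχ => subst hψ; exact hχ.1.elim
  | rule r hr ρ hprem ih =>
    have hsup := supported_iff.2 (hψ.symm ▸ Provable.rule r hr ρ hprem)
    injection hψ with hs ha hθ
    subst ha
    cases hst with
    | base hst =>
      -- `hE` only concerns the associated relation, which lies between `Supported P N` and
      -- `Supported P N'`.
      have h := supported_anti P hN _ _ _ hsup
      rw [supported_assocRel] at h
      obtain ⟨θ', h'⟩ := hE _ _ _ _ hst h
      rw [← supported_assocRel] at h'
      exact ⟨θ', supported_anti P hN' _ _ _ h'⟩
    | app f ξ ξ' hξ =>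
      obtain ⟨g, ζ, hrule⟩ := hsafe.exists_isNestedRule hr
      rw [hrule.src_subst] at hs
      injection hs with hf hs
      subst hf
      obtain rfl := eq_of_heq hs
      obtain ⟨ρ₀, hρ₁, hρ₂⟩ := exists_subst_eq hrule.src_different ξ' ρ
      have hρ : ∀ x : X Srt.s, InitClosure E Srt.s (ρ Srt.s x) (ρ₀ Srt.s x) := by
        intro x
        by_cases hx : IsOneOf x ζ
        · obtain ⟨i, hi⟩ := hx
          have : ∀ p : Σ σ : Srt, X σ, (⟨S.ar f i, ζ i⟩ : Σ σ : Srt, X σ) = p →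
              InitClosure E p.1 (ρ p.1 p.2) (ρ₀ p.1 p.2) := by
            rintro _ rfl
            change InitClosure E (S.ar f i) (ρ _ (ζ i)) (ρ₀ _ (ζ i))
            rw [hρ₁]
            exact hξ i
          exact this _ hi
        · rw [hρ₂ _ _ hx]
          exact .base (hEr _)
      obtain ⟨ρ', -, -, hsup'⟩ := hrule.exists_supported hr (N := N') ρ₀ (fun _ _ => True) (by
          intro t a μ hμ
          obtain ⟨θ', h'⟩ := ih _ hμ (InitClosure.subst t fun x _ => hρ x) rfl
          exact ⟨θ', h', trivial⟩) (by
          intro t b hb ρ' hρ' θ' h'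
          obtain ⟨θ'', h''⟩ := hneg (t.subst ρ) _ b θ'
            (InitClosure.subst t fun x _ => by rw [hρ']; exact hρ x) h'
          exact provable_neg_iff.1 (hprem _ hb) _ h'')
      rw [hrule.src_subst, funext hρ₁] at hsup'
      exact ⟨_, hsup'⟩

/-- Terms related by the closure `InitClosure E` have the same initial actions if terms related by
`E` do. -/
theorem InitClosure.exists_assocRel {E : Closed S Srt.s → Closed S Srt.s → Prop}
    (hEr : ∀ t, E t t) (hEs : ∀ s t, E s t → E t s)
    (hE : ∀ s t a θ, E s t → assocRel P hP s a θ → ∃ θ', assocRel P hP t a θ')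
    (hsafe : IsRBBSafe τ P) {s t : Closed S Srt.s} {a : A} {θ : Closed S Srt.d}
    (hst : InitClosure E Srt.s s t) (h : assocRel P hP s a θ) : ∃ θ', assocRel P hP t a θ' := by
  suffices H : ∀ s t a θ, InitClosure E Srt.s s t → assocRel P hP s a θ →
      ∃ θ', assocRel P hP t a θ' from H _ _ _ _ hst h
  refine (assocRel_isLeast P hP).induction (p := fun CT => ∀ s t a θ,
    InitClosure E Srt.s s t → CT s a θ → ∃ θ', assocRel P hP t a θ') ?_ ?_
  · intro CT hCT ih s t a θ hst h
    rw [← supported_assocRel P hP]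
    have hle : assocRel P hP ≤ Supported P CT :=
      (supported_assocRel P hP).ge.trans (supported_anti P hCT)
    refine InitClosure.exists_supported τ hP hEr hE hsafe hle le_rfl ?_ h hst
    -- The second half-step exchanges the roles of the two states; its own negative premises are
    -- covered by the induction hypothesis for `CT`.
    intro s t b θ hst h
    rw [← supported_assocRel P hP] at h
    exact InitClosure.exists_supported τ hP hEr hE hsafe le_rfl hCT
      (fun s t b θ hst h => ih t s b θ (hst.symm hEs) h) h (hst.symm hEs)
  · intro 𝒞 ih s t a θ hst h
    simp only [sSup_apply, iSup_apply, iSup_Prop_eq] at h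
    obtain ⟨⟨CT, hCT⟩, h⟩ := h
    exact ih CT hCT s t a θ hst h

/-! ### The congruence closures of the bisimilarities -/

variable (P)

/-- Branching bisimilarity of a complete PTSS on closed terms of both sorts. -/
def branchBisim : (σ : Srt) → Closed S σ → Closed S σ → Prop
  | .s, t, t' => BranchingBisimilar τ (assocPTS P hP) t t'
  | .d, θ, θ' => LiftRel (BranchingBisimilar τ (assocPTS P hP)) (sem θ) (sem θ')

theorem branchBisim_equivalence : ∀ σ, Equivalence (branchBisim τ P hP σ)
  | .s => BranchingBisimilar.equivalence τ (assocPTS P hP)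
  | .d => (LiftRel.equivalence (BranchingBisimilar.equivalence τ (assocPTS P hP))).comap sem

theorem rbBisim_equivalence : ∀ σ, Equivalence (rbBisim τ P hP σ)
  | .s => RootedBranchingBisimilar.equivalence τ (assocPTS P hP)
  | .d => (LiftRel.equivalence (RootedBranchingBisimilar.equivalence τ (assocPTS P hP))).comap sem

/-- The closure of rooted branching bisimilarity under all operators. -/
abbrev RootedClosure := CongClosure (rbBisim τ P hP)

/-- The closure of branching bisimilarity under operators with wild arguments. -/
abbrev BranchClosure := WildClosure P (RootedClosure τ P hP) (branchBisim τ P hP)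

theorem RootedClosure.refl {σ : Srt} (ξ : Closed S σ) : RootedClosure τ P hP σ ξ ξ :=
  .base ((rbBisim_equivalence τ P hP σ).refl ξ)

theorem RootedClosure.symm {σ : Srt} {ξ ξ' : Closed S σ} (h : RootedClosure τ P hP σ ξ ξ') :
    RootedClosure τ P hP σ ξ' ξ :=
  CongClosure.symm (fun σ _ _ => (rbBisim_equivalence τ P hP σ).symm) h

theorem BranchClosure.symm {σ : Srt} {ξ ξ' : Closed S σ} (h : BranchClosure τ P hP σ ξ ξ') :
    BranchClosure τ P hP σ ξ' ξ :=
  WildClosure.symm (R := RootedClosure τ P hP) (F := branchBisim τ P hP)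
    (fun _ _ _ => RootedClosure.symm τ P hP)
    (fun σ _ _ => (branchBisim_equivalence τ P hP σ).symm) h

theorem RootedClosure.liftRel_sem {θ θ' : Closed S Srt.d} (h : RootedClosure τ P hP Srt.d θ θ') :
    LiftRel (RootedClosure τ P hP Srt.s) (sem θ) (sem θ') :=
  CongClosure.liftRel_sem (fun _ _ h => h) h

theorem BranchClosure.liftRel_sem {θ θ' : Closed S Srt.d} (h : BranchClosure τ P hP Srt.d θ θ') :
    LiftRel (BranchClosure τ P hP Srt.s) (sem θ) (sem θ') :=
  WildClosure.liftRel_sem (fun _ _ h => RootedClosure.liftRel_sem τ P hP h) (fun _ _ h => h) h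

theorem rbBisim.exists_assocRel {s t : Closed S Srt.s} (h : rbBisim τ P hP Srt.s s t) {a : A}
    {θ : Closed S Srt.d} (hs : assocRel P hP s a θ) :
    ∃ θ', assocRel P hP t a θ' ∧ branchBisim τ P hP Srt.d θ θ' := by
  obtain ⟨-, ⟨θ', h', rfl⟩, hl⟩ :=
    (RootedBranchingBisimilar.isRootedBranchingBisim τ _).2 s t h a _ ⟨θ, hs, rfl⟩
  exact ⟨θ', h', hl⟩

variable {P}

theorem RootedClosure.not_assocRel (hsafe : IsRBBSafe τ P) {s t : Closed S Srt.s}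
    (h : InitClosure (rbBisim τ P hP Srt.s) Srt.s s t) {a : A}
    (hs : ∀ θ, ¬ assocRel P hP s a θ) (θ : Closed S Srt.d) : ¬ assocRel P hP t a θ := fun ht => by
  have hequiv := rbBisim_equivalence τ P hP Srt.s
  obtain ⟨θ', h'⟩ := InitClosure.exists_assocRel τ hP hequiv.refl (fun _ _ => hequiv.symm)
    (fun s t a θ hst hs => (rbBisim.exists_assocRel τ P hP hst hs).imp fun _ => And.left) hsafe
    (h.symm fun _ _ => hequiv.symm) ht
  exact hs θ' h'

end Congruence

section Transfer

variable {S : Signature.{u}} {X : Srt → Type v} {A : Type w} (τ : A) {P : PTSS S X A}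
  (hP : IsComplete P)

/-! ### Transfer along the closures -/

/-- A rule that applies to `f(ξ₁, …, ξₙ)` also applies to `f(η₁, …, ηₙ)` if the arguments are
related suitably and the positive premises can be matched. -/
theorem IsNestedRule.exists_assocRel (hsafe : IsRBBSafe τ P) {r : Rule S X A} {f : S.Op}
    {ζ : ∀ i : Fin (S.rk f), X (S.ar f i)} (hrule : IsNestedRule P r f ζ) (hr : r ∈ P)
    {ρ ρ₀ : Subst S X fun _ => Empty}
    (hw : ∀ i, Wild P f i → BranchClosure τ P hP (S.ar f i) (ρ _ (ζ i)) (ρ₀ _ (ζ i)))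
    (ht : ∀ i, ¬ Wild P f i → RootedClosure τ P hP (S.ar f i) (ρ _ (ζ i)) (ρ₀ _ (ζ i)))
    (hρ₀ : ∀ σ (z : X σ), ¬ IsOneOf z ζ → ρ₀ σ z = ρ σ z)
    (hpos : ∀ t a μ, Literal.pos t a (.var μ) ∈ r.prem →
      ∃ θ, assocRel P hP (t.subst ρ₀) a θ ∧ BranchClosure τ P hP Srt.d (ρ Srt.d μ) θ)
    (hneg : ∀ t b, Literal.neg t b ∈ r.prem →
      (∀ σ (z : X σ), (⟨σ, z⟩ : Σ σ : Srt, X σ) ∈ t.vars →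
        RootedClosure τ P hP σ (ρ σ z) (ρ₀ σ z)) ∧ ∀ θ, ¬ assocRel P hP (t.subst ρ) b θ) :
    ∃ θ, assocRel P hP (.app f fun i => ρ₀ _ (ζ i)) r.act θ ∧
      BranchClosure τ P hP Srt.d (r.tgt.subst ρ) θ := by
  obtain ⟨ρ', hρs, hρd, hsup⟩ := hrule.exists_supported hr (N := assocRel P hP) ρ₀
    (fun μ θ => BranchClosure τ P hP Srt.d (ρ Srt.d μ) θ)
    (by rw [supported_assocRel]; exact hpos) (by
      intro t b hb ρ' hρ'
      obtain ⟨hvars, hnot⟩ := hneg t b hb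
      refine RootedClosure.not_assocRel τ hP hsafe (InitClosure.subst t fun x hx => ?_) hnot
      rw [hρ']
      exact (hvars _ x hx).initClosure)
  rw [supported_assocRel, hrule.src_subst] at hsup
  refine ⟨_, hsup, WildClosure.subst r.tgt fun σ z _ => ?_⟩
  -- Before the premise targets are re-chosen, a variable is tame (or untouched), or it is wild and
  -- thus w-nested in the target.
  have hz : RootedClosure τ P hP σ (ρ σ z) (ρ₀ σ z) ∨
      BranchClosure τ P hP σ (ρ σ z) (ρ₀ σ z) ∧ OnlyWNested P z r.tgt := by
    by_cases hz : IsOneOf z ζ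
    · obtain ⟨i, hi⟩ := hz
      cases hi
      by_cases hi : Wild P f i
      · exact .inr ⟨hw i hi, hrule.wild_nested i hi⟩
      · exact .inl (ht i hi)
    · rw [hρ₀ σ z hz]
      exact .inl (RootedClosure.refl τ P hP _)
  cases σ with
  | s => rw [hρs]; exact hz
  | d =>
    rcases hρd z with ⟨t, a, hta, hW⟩ | h
    · exact .inr ⟨hW, hrule.target_nested t a z hta⟩
    · rw [h]; exact hz

/-- All variables in premise sources are related by the full congruence closure, so the induction
hypothesis answers positive premises without τ-steps in advance. The weaker `BranchClosure` enters
through the targets, as rooted bisimilarity only promises branching bisimilar targets. -/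
theorem RootedClosure.exists_assocRel (hsafe : IsRBBSafe τ P) {s t : Closed S Srt.s}
    (hst : RootedClosure τ P hP Srt.s s t) {a : A} {θ : Closed S Srt.d}
    (h : assocRel P hP s a θ) :
    ∃ θ', assocRel P hP t a θ' ∧ BranchClosure τ P hP Srt.d θ θ' := by
  have hsup := h
  rw [← supported_assocRel, supported_iff] at hsup
  generalize hψ : Literal.pos s a θ = ψ at hsup
  induction hsup generalizing s t a θ with
  | hyp χ hχ => subst hψ; exact hχ.1.elim
  | rule r hr ρ hprem ih =>
    injection hψ with hs ha hθ
    subst ha hθ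
    cases hst with
    | base hst =>
      obtain ⟨θ', h', hb⟩ := rbBisim.exists_assocRel τ P hP hst h
      exact ⟨θ', h', .base hb⟩
    | app f ξ ξ' hξ =>
      obtain ⟨g, ζ, hrule⟩ := hsafe.exists_isNestedRule hr
      rw [hrule.src_subst] at hs
      injection hs with hf hs
      subst hf
      obtain rfl := eq_of_heq hs
      obtain ⟨ρ₀, hρ₁, hρ₂⟩ := exists_subst_eq hrule.src_different ξ' ρ
      have hρ : ∀ σ (z : X σ), RootedClosure τ P hP σ (ρ σ z) (ρ₀ σ z) := by
        intro σ z
        by_cases hz : IsOneOf z ζ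
        · obtain ⟨i, hi⟩ := hz
          cases hi
          rw [hρ₁]
          exact hξ i
        · rw [hρ₂ _ _ hz]
          exact RootedClosure.refl τ P hP _
      rw [← funext hρ₁]
      refine hrule.exists_assocRel τ hP hsafe hr (fun i _ => .tame (hρ _ _)) (fun i _ => hρ _ _)
        hρ₂ (fun t a μ hμ => ?_) fun t b hb => ⟨fun σ z _ => hρ σ z, provable_neg_iff.1 (hprem _ hb)⟩
      refine ih _ hμ (CongClosure.subst t fun σ z _ => hρ σ z) ?_ rfl
      rw [← supported_assocRel P hP, supported_iff]
      exact hprem _ hμ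

theorem HasPatienceRule.exists_assocRel {f : S.Op} {i : Fin (S.rk f)}
    (h : HasPatienceRule τ P f i) (hi : S.ar f i = Srt.s)
    (ξ : ∀ i : Fin (S.rk f), Closed S (S.ar f i)) {θ : Closed S Srt.d}
    (hθ : assocRel P hP (toState hi (ξ i)) τ θ) :
    ∃ θs : Fin (S.rk f) → Closed S Srt.d, assocRel P hP (.app f ξ) τ (.lift f θs) ∧ θs i = θ ∧
      ∀ j, j ≠ i → IsPointMass (ξ j) (θs j) := by
  obtain ⟨r, hr, ζ, x, μ, θ₀, hζ, hμ, hx, hprem, hsrc, hact, htgt, hθi, hbar⟩ := h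
  obtain ⟨_, hto⟩ := exists_toState_subst (S := S) hx
  obtain ⟨ρ, hρ, hρ'⟩ := exists_subst_eq (Y := fun _ => Empty) hζ ξ fun σ => match σ with
    | .s => fun _ => toState hi (ξ i)
    | .d => fun _ => θ
  have hx' : ρ Srt.s x = toState hi (ξ i) := by rw [← hto ρ, hρ]
  have hμ' : ρ Srt.d μ = θ := hρ' _ _ hμ
  refine ⟨fun j => (θ₀ j).subst ρ, ?_, (congrArg (Term.subst ρ) hθi).trans hμ', fun j hj => ?_⟩
  · have hpr : Provable P (negativeTheory (assocRel P hP)) (r.conc.subst ρ) := by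
      refine .rule r hr ρ fun φ hφ => ?_
      rw [hprem, Set.mem_singleton_iff] at hφ
      subst hφ
      change Provable P _ (.pos (ρ Srt.s x) τ (ρ Srt.d μ))
      rwa [hx', hμ', ← supported_iff, supported_assocRel]
    rw [Rule.conc, hsrc, hact, htgt] at hpr
    rw [← supported_assocRel P hP, supported_iff, ← funext hρ]
    exact hpr
  · rw [← hρ]
    exact (hbar j hj).isPointMass ρ

/-- A patience rule turns τ-steps of one argument into τ-steps of the whole term. The intermediate
states remain related to `f(ξ)` because the moving argument is wild. -/
theorem TauPath.app {f : S.Op} {i : Fin (S.rk f)} (h : HasPatienceRule τ P f i)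
    (hi : S.ar f i = Srt.s) (hwild : Wild P f i) {ξ η : ∀ i : Fin (S.rk f), Closed S (S.ar f i)}
    (hw : ∀ i, Wild P f i → BranchClosure τ P hP (S.ar f i) (ξ i) (η i))
    (ht : ∀ i, ¬ Wild P f i → RootedClosure τ P hP (S.ar f i) (ξ i) (η i))
    {u u' : Closed S Srt.s}
    (hp : TauPath τ (assocPTS P hP) (BranchClosure τ P hP Srt.s) (toState hi (ξ i)) u u') :
    TauPath τ (assocPTS P hP) (BranchClosure τ P hP Srt.s) (.app f ξ)
      (.app f (Function.update η i (ofState hi u)))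
      (.app f (Function.update η i (ofState hi u'))) := by
  have key : ∀ u, BranchClosure τ P hP Srt.s (toState hi (ξ i)) u →
      BranchClosure τ P hP Srt.s (.app f ξ) (.app f (Function.update η i (ofState hi u))) := by
    intro u hu
    refine .app f _ _ (fun j hj => ?_) fun j hj => ?_
    · rcases eq_or_ne j i with rfl | hji
      · rw [Function.update_self]
        rw [← toState_ofState hi u] at hu
        exact (rel_toState_iff hi).1 hu
      · rw [Function.update_of_ne hji]
        exact hw j hj
    · rw [Function.update_of_ne (show j ≠ i from fun h => hj (h ▸ hwild))]
      exact ht j hj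
  induction hp with
  | nil hB => exact .nil (key _ hB)
  | @cons t t₁ _ _ hB htr hπ ht₁ _ ih =>
    obtain ⟨θ, hθ, rfl⟩ := htr
    obtain ⟨θs, hθs, rfl, hpm⟩ := h.exists_assocRel τ hP hi
      (Function.update η i (ofState hi t)) (by rwa [Function.update_self, toState_ofState])
    have hsupp := fun {y : Closed S Srt.s} => mem_support_sem_lift hi hpm (t := y)
    simp only [Function.update_idem] at hsupp
    refine .cons (key _ hB) ⟨_, hθs, rfl⟩ (liftRel_pure_left.2 fun y hy => ?_)
      (hsupp.2 ⟨t₁, ht₁, rfl⟩) ih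
    obtain ⟨u, hu, rfl⟩ := hsupp.1 hy
    exact key u (liftRel_pure_left.1 hπ u hu)

/-- The paths of the separate arguments are run one after another. -/
theorem TauPath.app_of_forall {f : S.Op} {ξ ξ' η : ∀ i : Fin (S.rk f), Closed S (S.ar f i)}
    (hw : ∀ i, Wild P f i → BranchClosure τ P hP (S.ar f i) (ξ i) (ξ' i))
    (ht : ∀ i, ¬ Wild P f i → RootedClosure τ P hP (S.ar f i) (ξ i) (ξ' i))
    (hη : ∀ i, η i = ξ' i ∨ ∃ hi : S.ar f i = Srt.s, Wild P f i ∧ HasPatienceRule τ P f i ∧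
      TauPath τ (assocPTS P hP) (BranchClosure τ P hP Srt.s) (toState hi (ξ i))
        (toState hi (ξ' i)) (toState hi (η i))) :
    (∀ i, Wild P f i → BranchClosure τ P hP (S.ar f i) (ξ i) (η i)) ∧
    (∀ i, ¬ Wild P f i → RootedClosure τ P hP (S.ar f i) (ξ i) (η i)) ∧
    TauPath τ (assocPTS P hP) (BranchClosure τ P hP Srt.s) (.app f ξ) (.app f ξ') (.app f η) := by
  have hwη : ∀ i, Wild P f i → BranchClosure τ P hP (S.ar f i) (ξ i) (η i) := by
    intro i hi
    rcases hη i with h | ⟨hs, -, -, hp⟩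
    · rw [h]; exact hw i hi
    · exact (rel_toState_iff hs).1 hp.rel_last
  have htη : ∀ i, ¬ Wild P f i → RootedClosure τ P hP (S.ar f i) (ξ i) (η i) := by
    intro i hi
    rcases hη i with h | ⟨-, hwi, -⟩
    · rw [h]; exact ht i hi
    · exact (hi hwi).elim
  refine ⟨hwη, htη, ?_⟩
  -- The arguments in `s` have already completed their paths; the others are still at `ξ'`.
  suffices H : ∀ s : Finset (Fin (S.rk f)), TauPath τ (assocPTS P hP)
      (BranchClosure τ P hP Srt.s) (.app f ξ) (.app f ξ') (.app f (s.piecewise η ξ')) by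
    simpa using H Finset.univ
  intro s
  induction s using Finset.induction_on with
  | empty => rw [Finset.piecewise_empty]; exact .nil (.app f _ _ hw ht)
  | insert i s hi ih =>
    refine ih.trans ?_
    rw [Finset.piecewise_insert]
    have hself : s.piecewise η ξ' i = ξ' i := Finset.piecewise_eq_of_notMem _ _ _ hi
    rcases hη i with h | ⟨hs, hwi, hpat, hp⟩
    · rw [h, ← hself, Function.update_eq_self]
      exact .nil ih.rel_last
    · have := TauPath.app τ hP hpat hs hwi (η := s.piecewise η ξ') ?_ ?_ hp
      · rwa [ofState_toState, ofState_toState, ← hself, Function.update_eq_self] at this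
      · exact fun j hj => s.piecewise_cases η ξ' (fun y => BranchClosure τ P hP _ (ξ j) y)
          (hwη j hj) (hw j hj)
      · exact fun j hj => s.piecewise_cases η ξ' (fun y => RootedClosure τ P hP _ (ξ j) y)
          (htη j hj) (ht j hj)

end Transfer

/-! ### Branching transfer and the congruence theorem -/

section Main

variable {S : Signature.{u}} {X : Srt → Type v} {A : Type w} (τ : A) {P : PTSS S X A}
  (hP : IsComplete P)

/-- The transfer property of the branching closure, on symbolic transitions. -/
def BranchTransfer (s t : Closed S Srt.s) : Prop :=
  ∀ a θ, assocRel P hP s a θ →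
    (a = τ ∧ ∀ s' ∈ (sem θ).support, BranchClosure τ P hP Srt.s s' t) ∨
    ∃ t' θ', TauPath τ (assocPTS P hP) (BranchClosure τ P hP Srt.s) s t t' ∧
      assocRel P hP t' a θ' ∧ BranchClosure τ P hP Srt.d θ θ'

/-- `BranchTransfer` on state terms, and no constraint on distribution terms. -/
def SortedBranchTransfer : (σ : Srt) → Closed S σ → Closed S σ → Prop
  | .s, s, t => BranchTransfer τ hP s t
  | .d, _, _ => True

/-- The step originates in argument `i`. If it is inert there, it is inert for the whole term;
otherwise its match is lifted along the path and once more for the final τ-step. -/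
theorem branchTransfer_app_of_patience {f : S.Op}
    {ξ ξ' : ∀ i : Fin (S.rk f), Closed S (S.ar f i)}
    (hw : ∀ i, Wild P f i → BranchClosure τ P hP (S.ar f i) (ξ i) (ξ' i))
    (ht : ∀ i, ¬ Wild P f i → RootedClosure τ P hP (S.ar f i) (ξ i) (ξ' i))
    {i : Fin (S.rk f)} (hi : S.ar f i = Srt.s) (hwi : Wild P f i) (hpat : HasPatienceRule τ P f i)
    (ih : BranchTransfer τ hP (toState hi (ξ i)) (toState hi (ξ' i)))
    {θ : Fin (S.rk f) → Closed S Srt.d} (hθ : assocRel P hP (toState hi (ξ i)) τ (θ i))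
    (hpm : ∀ j, j ≠ i → IsPointMass (ξ j) (θ j)) :
    (∀ s' ∈ (sem (.lift f θ)).support, BranchClosure τ P hP Srt.s s' (.app f ξ')) ∨
    ∃ t' θ', TauPath τ (assocPTS P hP) (BranchClosure τ P hP Srt.s) (.app f ξ) (.app f ξ') t' ∧
      assocRel P hP t' τ θ' ∧ BranchClosure τ P hP Srt.d (.lift f θ) θ' := by
  rcases ih τ _ hθ with ⟨-, hin⟩ | ⟨t', θ', hpath, htr, hW⟩
  · refine .inl fun s' hs' => ?_
    obtain ⟨u, hu, rfl⟩ := (mem_support_sem_lift hi hpm).1 hs'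
    refine .app f _ _ (fun j hj => ?_) fun j hj => ?_
    · rcases eq_or_ne j i with rfl | hji
      · have := hin u hu
        rw [← toState_ofState hi u] at this
        rw [Function.update_self]
        exact (rel_toState_iff hi).1 this
      · rw [Function.update_of_ne hji]
        exact hw j hj
    · rw [Function.update_of_ne (show j ≠ i from fun h => hj (h ▸ hwi))]
      exact ht j hj
  · have hp := TauPath.app τ hP hpat hi hwi hw ht hpath
    rw [ofState_toState, Function.update_eq_self] at hp
    obtain ⟨θs, hθs, rfl, hpm'⟩ := hpat.exists_assocRel τ hP hi
      (Function.update ξ' i (ofState hi t')) (by rwa [Function.update_self, toState_ofState])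
    have hpm'' : ∀ j, j ≠ i → IsPointMass (ξ' j) (θs j) := by
      intro j hj
      have := hpm' j hj
      rwa [Function.update_of_ne hj] at this
    refine .inr ⟨_, _, hp, hθs, .lift f _ _ (fun j hj => ?_) fun j hj => ?_⟩
    · rcases eq_or_ne j i with rfl | hji
      · exact hW
      · exact (hpm j hji).wildClosure (hpm'' j hji) (hw j hj)
    · have hji : j ≠ i := fun h => hj (h ▸ hwi)
      exact (hpm j hji).congClosure (hpm'' j hji) (ht j hj)

/-- All tested wild arguments first move, by patience, to states enabling the required actions; then
the same rule fires. Tame arguments do not move, since `RootedClosure` matches their tests at once.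
-/
theorem branchTransfer_app_of_safe (hsafe : IsRBBSafe τ P) {r : Rule S X A} (hr : r ∈ P) {f : S.Op}
    {ζ : ∀ i : Fin (S.rk f), X (S.ar f i)} (hrule : IsRBBSafeRule τ P r f ζ)
    {ρ : Subst S X fun _ => Empty} {ξ' : ∀ i : Fin (S.rk f), Closed S (S.ar f i)}
    (hw : ∀ i, Wild P f i → BranchClosure τ P hP (S.ar f i) (ρ _ (ζ i)) (ξ' i))
    (ht : ∀ i, ¬ Wild P f i → RootedClosure τ P hP (S.ar f i) (ρ _ (ζ i)) (ξ' i))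
    (ih : ∀ i, Wild P f i → SortedBranchTransfer τ hP (S.ar f i) (ρ _ (ζ i)) (ξ' i))
    (hprem : ∀ φ ∈ r.prem, Provable P (negativeTheory (assocRel P hP)) (φ.subst ρ)) :
    ∃ t' θ', TauPath τ (assocPTS P hP) (BranchClosure τ P hP Srt.s) (.app f fun i => ρ _ (ζ i))
        (.app f ξ') t' ∧
      assocRel P hP t' r.act θ' ∧ BranchClosure τ P hP Srt.d (r.tgt.subst ρ) θ' := by
  have hposPrem : ∀ t a μ, Literal.pos t a (.var μ) ∈ r.prem →
      assocRel P hP (t.subst ρ) a (ρ Srt.d μ) := by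
    intro t a μ hμ
    rw [← supported_assocRel P hP, supported_iff]
    exact hprem _ hμ
  have hη : ∀ i, ∃ y : Closed S (S.ar f i),
      (y = ξ' i ∨ ∃ hi : S.ar f i = Srt.s, Wild P f i ∧ HasPatienceRule τ P f i ∧
        TauPath τ (assocPTS P hP) (BranchClosure τ P hP Srt.s) (toState hi (ρ _ (ζ i)))
          (toState hi (ξ' i)) (toState hi y)) ∧
      (Wild P f i → HasPatienceRule τ P f i → ∀ x a μ,
        (⟨S.ar f i, ζ i⟩ : Σ σ : Srt, X σ) = ⟨Srt.s, x⟩ →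
        Literal.pos (.var x) a (.var μ) ∈ r.prem → ∀ hi : S.ar f i = Srt.s,
        ∃ θ', assocRel P hP (toState hi y) a θ' ∧ BranchClosure τ P hP Srt.d (ρ Srt.d μ) θ') := by
    intro i
    by_cases hex : Wild P f i ∧ HasPatienceRule τ P f i ∧ ∃ x a μ,
        (⟨S.ar f i, ζ i⟩ : Σ σ : Srt, X σ) = ⟨Srt.s, x⟩ ∧
        Literal.pos (.var x) a (.var μ) ∈ r.prem
    · obtain ⟨hwi, hpat, x, a, μ, hx, hμ⟩ := hex
      obtain ⟨hall, huniq⟩ := hrule.wild_patience i hwi hpat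
      have hmem : ∀ a' (μ' : X Srt.d), (⟨S.ar f i, ζ i⟩ : Σ σ : Srt, X σ) ∈
          (Literal.pos (.var x) a' (.var μ') : Literal S X A).vars :=
        fun _ _ => .inl hx
      obtain ⟨x', a', μ', -, ha', heq⟩ := hall _ hμ (hmem _ _)
      injection heq with _ heq _
      subst heq
      obtain ⟨hi, hto⟩ := exists_toState_subst (S := S) hx
      have htrans : BranchTransfer τ hP (toState hi (ρ _ (ζ i))) (toState hi (ξ' i)) :=
        (rel_toState_iff (R := SortedBranchTransfer τ hP) hi).2 (ih i hwi)
      have hprem' := hposPrem _ _ _ hμ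
      rw [Term.subst, ← hto ρ] at hprem'
      rcases htrans _ _ hprem' with ⟨h, -⟩ | ⟨t', θ', hpath, htr, hW⟩
      -- The tested action is not `τ`, so the inert alternative is impossible.
      · exact (ha' h).elim
      · refine ⟨ofState hi t', .inr ⟨hi, hwi, hpat, by rwa [toState_ofState]⟩, ?_⟩
        intro _ _ x' a' μ' hx' hμ' _
        obtain rfl : x = x' := by
          have := hx.symm.trans hx'
          cases this
          rfl
        -- The argument is tested by one premise only, so the end of a single path satisfies every
        -- demand on it.
        have := huniq _ hμ _ hμ' (hmem _ _) (hmem _ _)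
        injection this with _ h₂ h₃
        injection h₃ with _ h₃
        subst h₂ h₃
        exact ⟨θ', by rwa [toState_ofState], hW⟩
    · exact ⟨ξ' i, .inl rfl, fun hwi hpat x a μ hx hμ =>
        (hex ⟨hwi, hpat, x, a, μ, hx, hμ⟩).elim⟩
  choose η hη₁ hη₂ using hη
  obtain ⟨hwη, htη, hpath⟩ := TauPath.app_of_forall τ hP hw ht hη₁
  obtain ⟨ρ₀, hρ₁, hρ₂⟩ := exists_subst_eq hrule.src_different η ρ
  have hρ : ∀ σ (z : X σ), (∀ i, Wild P f i → (⟨S.ar f i, ζ i⟩ : Σ σ : Srt, X σ) ≠ ⟨σ, z⟩) →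
      RootedClosure τ P hP σ (ρ σ z) (ρ₀ σ z) := by
    intro σ z hnot
    by_cases hz : IsOneOf z ζ
    · obtain ⟨i, hi⟩ := hz
      cases hi
      rw [hρ₁]
      exact htη i fun hwi => hnot i hwi rfl
    · rw [hρ₂ _ _ hz]
      exact RootedClosure.refl τ P hP _
  obtain ⟨θ', hθ', hW⟩ := hrule.isNestedRule.exists_assocRel τ hP hsafe hr (ρ := ρ) (ρ₀ := ρ₀)
    (fun i hi => by rw [hρ₁]; exact hwη i hi) (fun i hi => by rw [hρ₁]; exact htη i hi) hρ₂
    (by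
      intro t a μ hμ
      -- A premise whose source contains a wild argument tests exactly that argument, which has
      -- already moved. In any other premise source all variables are related by `RootedClosure`.
      by_cases hex : ∃ i, Wild P f i ∧ (⟨S.ar f i, ζ i⟩ : Σ σ : Srt, X σ) ∈ t.vars
      · obtain ⟨i, hwi, hmem⟩ := hex
        by_cases hpat : HasPatienceRule τ P f i
        · obtain ⟨x, a', μ', hx, -, heq⟩ := (hrule.wild_patience i hwi hpat).1 _ hμ (.inl hmem)
          injection heq with h₁ h₂ h₃
          injection h₃ with _ h₃
          subst h₁ h₂ h₃
          obtain ⟨hi, hto⟩ := exists_toState_subst (S := S) hx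
          rw [Term.subst, ← hto ρ₀, hρ₁]
          exact hη₂ i hwi hpat x a μ hx hμ hi
        · exact (hrule.wild_no_patience i hwi hpat _ hμ hmem).elim
      · push Not at hex
        refine RootedClosure.exists_assocRel τ hP hsafe (CongClosure.subst t fun σ z hz => ?_)
          (hposPrem t a μ hμ)
        exact hρ σ z fun i hwi h => hex i hwi (h ▸ hz))
    (by
      intro t b hb
      refine ⟨fun σ z hz => hρ σ z fun i hwi h => ?_, provable_neg_iff.1 (hprem _ hb)⟩
      rw [← h] at hz
      -- No wild argument occurs in a negative premise: with a patience rule only a positive premise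
      -- may contain it, and without one no premise source may.
      by_cases hpat : HasPatienceRule τ P f i
      · obtain ⟨x, a', μ', -, -, heq⟩ := (hrule.wild_patience i hwi hpat).1 _ hb hz
        cases heq
      · exact hrule.wild_no_patience i hwi hpat _ hb hz)
  rw [funext hρ₁] at hθ'
  exact ⟨_, θ', hpath, hθ', hW⟩

/-- Induction on the closure: the generating cases are the transfer properties of the two generating
relations, and an operator splits according to whether the last rule is a patience rule or an RBB
safe rule. -/
theorem BranchClosure.sortedBranchTransfer (hsafe : IsRBBSafe τ P) {σ : Srt} {ξ ξ' : Closed S σ}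
    (h : BranchClosure τ P hP σ ξ ξ') : SortedBranchTransfer τ hP σ ξ ξ' := by
  induction h with
  | @base σ s t h =>
    cases σ with
    | d => trivial
    | s =>
      intro a θ hs
      rcases (BranchingBisimilar.isBranchingTransfer τ (assocPTS P hP)).transfer s t h a _
        ⟨θ, hs, rfl⟩ with ⟨ha, hin⟩ | ⟨t', -, hpath, ⟨θ', hθ', rfl⟩, hl⟩
      · exact .inl ⟨ha, fun s' hs' => .base (hin s' hs')⟩
      · exact .inr ⟨t', θ', hpath.mono fun _ hu => .base hu, hθ', .base hl⟩
  | @tame σ s t h =>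
    cases σ with
    | d => trivial
    | s =>
      intro a θ hs
      obtain ⟨θ', hθ', hW⟩ := RootedClosure.exists_assocRel τ hP hsafe h hs
      exact .inr ⟨t, θ', .nil (.tame h), hθ', hW⟩
  | lift => trivial
  | dirac => trivial
  | mix => trivial
  | app f ξ ξ' hw ht ih =>
    intro a θ hs
    rw [← supported_assocRel P hP] at hs
    obtain ⟨r, hr, ρ, hsrc, rfl, rfl, hprem⟩ := hs.exists_rule
    rcases hsafe r hr with ⟨g, i, hwi, hpatr⟩ | ⟨g, ζ, hrule⟩
    · have hpat : HasPatienceRule τ P g i := ⟨r, hr, hpatr⟩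
      obtain ⟨ζ, x, μ, θ₀, hζ, hμ, hx, hpr, hsrc', hact, htgt, hθi, hbar⟩ := hpatr
      rw [hsrc'] at hsrc
      injection hsrc with hg hξ
      subst hg
      obtain rfl := eq_of_heq hξ
      obtain ⟨hi, hto⟩ := exists_toState_subst (S := S) hx
      have hx' : assocRel P hP (toState hi (ρ _ (ζ i))) τ ((θ₀ i).subst ρ) := by
        rw [hto, hθi, ← supported_assocRel P hP, supported_iff]
        exact hprem (.pos (.var x) τ (.var μ)) (by rw [hpr]; rfl)
      rw [hact, htgt]
      refine (branchTransfer_app_of_patience τ hP (ξ := fun j => ρ _ (ζ j))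
        (θ := fun j => (θ₀ j).subst ρ) hw ht hi hwi hpat
        ((rel_toState_iff (R := SortedBranchTransfer τ hP) hi).2 (ih i hwi)) hx' ?_).imp_left
        fun h => ⟨rfl, h⟩
      exact fun j hj => (hbar j hj).isPointMass ρ
    · rw [hrule.isNestedRule.src_subst] at hsrc
      injection hsrc with hg hξ
      subst hg
      obtain rfl := eq_of_heq hξ
      exact .inr (branchTransfer_app_of_safe τ hP hsafe hr hrule hw ht ih hprem)

theorem BranchClosure.isBranchingTransfer (hsafe : IsRBBSafe τ P) :
    IsBranchingTransfer τ (assocPTS P hP) (BranchClosure τ P hP Srt.s) where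
  symm _ _ h := BranchClosure.symm τ P hP h
  transfer := by
    rintro s t h a _ ⟨θ, hs, rfl⟩
    rcases BranchClosure.sortedBranchTransfer τ hP hsafe h a θ hs with
      hin | ⟨t', θ', hpath, hθ', hW⟩
    · exact .inl hin
    · exact .inr ⟨t', _, hpath, ⟨θ', hθ', rfl⟩, BranchClosure.liftRel_sem τ P hP hW⟩

/-- The targets of matched transitions are related by `BranchClosure`, which is now known to lie
within branching bisimilarity. -/
theorem RootedClosure.isRootedBranchingBisim (hsafe : IsRBBSafe τ P) :
    IsRootedBranchingBisim τ (assocPTS P hP) (RootedClosure τ P hP Srt.s) := by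
  refine ⟨fun _ _ => RootedClosure.symm τ P hP, ?_⟩
  rintro s t h a _ ⟨θ, hs, rfl⟩
  obtain ⟨θ', hθ', hW⟩ := RootedClosure.exists_assocRel τ hP hsafe h hs
  exact ⟨_, ⟨θ', hθ', rfl⟩, (BranchClosure.liftRel_sem τ P hP hW).mono fun _ _ =>
    (BranchClosure.isBranchingTransfer τ hP hsafe).branchingBisimilar⟩

theorem RootedClosure.rbBisim (hsafe : IsRBBSafe τ P) {σ : Srt} {ξ ξ' : Closed S σ}
    (h : RootedClosure τ P hP σ ξ ξ') : rbBisim τ P hP σ ξ ξ' := by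
  have hs : ∀ s t, RootedClosure τ P hP Srt.s s t → ProbSOS.rbBisim τ P hP Srt.s s t :=
    fun _ _ h => ⟨_, RootedClosure.isRootedBranchingBisim τ hP hsafe, h⟩
  cases σ with
  | s => exact hs _ _ h
  | d => exact (RootedClosure.liftRel_sem τ P hP h).mono hs

end Main

end ProbSOS

theorem mainTheorem1 {S : ProbSOS.Signature.{u}} {X : ProbSOS.Srt → Type v}
    [∀ σ : ProbSOS.Srt, Infinite (X σ)] {A : Type w} (τ : A) (P : ProbSOS.PTSS S X A)
    (hcomplete : ProbSOS.IsComplete P) (hsafe : ProbSOS.IsRBBSafe τ P) :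
    ProbSOS.IsCongruence (ProbSOS.rbBisim τ P hcomplete) where
  equivalence := ProbSOS.rbBisim_equivalence τ P hcomplete
  app f _ _ h := ProbSOS.RootedClosure.rbBisim τ hcomplete hsafe (.app f _ _ fun i => .base (h i))
  lift f _ _ h := ProbSOS.RootedClosure.rbBisim τ hcomplete hsafe (.lift f _ _ fun i => .base (h i))
  dirac hd _ _ h := ProbSOS.RootedClosure.rbBisim τ hcomplete hsafe (.dirac hd _ _ (.base h))
  mix _ p hp _ _ h :=
    ProbSOS.RootedClosure.rbBisim τ hcomplete hsafe (.mix p hp _ _ fun i => .base (h i))
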